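/- Let $p_1,p_2,p_3,\dots$ be the power sum symmetric functions and let $t$ be an indeterminate. Consider (completed) symmetric functions with coefficients in $\mathbb{Q}(t)$, that is, formal power series $f=f(p_1,p_2,\dots)$ in the power sums. The plethysm $f\circ g$, for $g$ without constant term, is obtained by replacing each $p_k$ in $f$ by $p_k\circ g$, where $p_k\circ g$ is obtained from $g$ by replacing each $p_l$ by $p_{kl}$ and $t$ by $t^k$. The suspension of $f$ is $$\Sigma_t f=-\tfrac1t\, f(-tp_1,-t^2p_2,-t^3p_3,\dots).$$ Let $\operatorname{Comm}=\exp\bigl(\sum_{k\ge1}p_k/k\bigr)-1$, and let $\operatorname{PreLie}=\sum_{n\geq 1}\operatorname{ch}(\operatorname{PreLie}(n))$, where $\operatorname{PreLie}(n)$ is the permutation representation of $\mathfrak S_n$ spanned by the rooted trees with vertex set $\{1,\dots,n\}$, and $\operatorname{ch}$ is the Frobenius characteristic $\operatorname{ch}(V)=\frac1{n!}\sum_{\sigma\in\mathfrak S_n}\chi_V(\sigma)\,p_{\operatorname{type}(\sigma)}$. For a partition $\lambda$, let $\lambda_k$ be the number of parts of $\lambda$ of size $k$, let $p_\lambda=\prod_k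 p_k^{\lambda_k}$ and $z_\lambda=\prod_k k^{\lambda_k}\lambda_k!$, and let $f_k(\lambda)$ be the number of fixed points of the $k$-th power of a permutation of cycle type $\lambda$. Then $$(\Sigma_t \operatorname{Comm})\circ\operatorname{PreLie}=\sum_{\lambda,\ |\lambda|\ge1}(\lambda_1-t)^{\lambda_1-1}\prod_{k\ge2}\Bigl((f_k(\lambda)-t^k)^{\lambda_k}-k\lambda_k\,(f_k(\lambda)-t^k)^{\lambda_k-1}\Bigr)\frac{p_\lambda}{z_\lambda},$$ where the sum is over all partitions $\lambda$ of positive integers, each monomial in the $p_k$ occurring in only finitely many terms. -/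

import Mathlib

open MvPowerSeries

noncomputable section

/-! ## The completed ring of symmetric functions

The coefficients are the rational functions over `ℚ` in one indeterminate `t`.  In characteristic
zero, the ring of symmetric functions (completed with respect to the degree) is the ring of formal
power series in the power sums `p 1, p 2, p 3, …`, which are algebraically independent. -/

/-- The field of coefficients `ℚ(t)`. -/
abbrev Coef : Type := RatFunc ℚ

/-- The indeterminate `t`. -/
def tVar : Coef := RatFunc.X

/-- Completed symmetric functions with coefficients in `ℚ(t)`, written in the power sums. -/
abbrev SymFn : Type := MvPowerSeries ℕ+ Coef

/-- The power sum `p_k`, for `k ≥ 1`. -/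
def pSum (k : ℕ+) : SymFn := X k

/-- The power sum `p_μ`, the product of the `p_k` over the parts `k` of the partition `μ`
(all parts are positive, so `Nat.toPNat'` only changes the type of `k`). -/
def pPart {n : ℕ} (μ : n.Partition) : SymFn :=
  (μ.parts.map fun k => pSum k.toPNat').prod

/-- The classical constant `z_μ = ∏ k ^ μ_k * μ_k !`, where `μ_k` is the number of parts of
size `k`. -/
def zPart {n : ℕ} (μ : n.Partition) : ℕ :=
  ∏ k ∈ μ.parts.toFinset, k ^ μ.parts.count k * (μ.parts.count k).factorial

/-- A family of series is locally finite if each monomial occurs in finitely many of its members;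
exactly such families have a formal sum. -/
def FormallySummable {ι : Type} (F : ι → SymFn) : Prop :=
  ∀ d : ℕ+ →₀ ℕ, {i | coeff d (F i) ≠ 0}.Finite

/-- The formal, coefficientwise, sum of a locally finite family of series. -/
def formalSum {ι : Type} (F : ι → SymFn) : SymFn :=
  fun d => ∑ᶠ i, coeff d (F i)

/-! ## Plethysm and suspension -/

theorem expand_nonZeroDivisors (k : ℕ+) :
    nonZeroDivisors (Polynomial ℚ) ≤
      (nonZeroDivisors (Polynomial ℚ)).comap (Polynomial.expand ℚ (k : ℕ)) := by
  intro f hf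
  rw [Submonoid.mem_comap, mem_nonZeroDivisors_iff_ne_zero]
  rw [mem_nonZeroDivisors_iff_ne_zero] at hf
  exact (Polynomial.expand_ne_zero k.pos).2 hf

/-- The endomorphism `c(t) ↦ c(t ^ k)` of the coefficients. -/
def coefAdams (k : ℕ+) : Coef →+* Coef :=
  RatFunc.mapRingHom (Polynomial.expand ℚ (k : ℕ)) (expand_nonZeroDivisors k)

/-- The plethysm `p_k ∘ g`: each `p_l` is replaced by `p_{kl}`, and `t` by `t ^ k`. -/
def adams (k : ℕ+) (g : SymFn) : SymFn :=
  subst (fun l : ℕ+ => pSum (k * l)) (MvPowerSeries.map (coefAdams k) g)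

/-- The plethysm `f ∘ g`, for `g` without constant term: each `p_k` in `f` is replaced by
`p_k ∘ g`. -/
def plethysm (f g : SymFn) : SymFn :=
  subst (fun k : ℕ+ => adams k g) f

/-- The suspension `Σ_t f = -(1/t) f(-t p_1, -t² p_2, -t³ p_3, …)`. -/
def suspension (f : SymFn) : SymFn :=
  C (-(1 / tVar)) * rescale (fun k : ℕ+ => -tVar ^ (k : ℕ)) f

/-- `Comm = exp (∑_{k ≥ 1} p_k / k) - 1`. -/
def symComm : SymFn :=
  PowerSeries.subst (formalSum fun k : ℕ+ => C (1 / ((k : ℕ) : Coef)) * pSum k)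
    (PowerSeries.exp Coef) - 1

/-! ## Frobenius characteristic and rooted trees -/

/-- The Frobenius characteristic `(1 / n!) ∑_σ χ(σ) p_{type(σ)}` of a representation of the
symmetric group on `n` letters.  Here `Equiv.Perm.partition` is the cycle type, fixed points
included. -/
def frobeniusChar {n : ℕ} {V : Type} [AddCommGroup V] [Module ℚ V]
    (ρ : Representation ℚ (Equiv.Perm (Fin n)) V) : SymFn :=
  C (1 / (n.factorial : Coef)) * ∑ σ : Equiv.Perm (Fin n),
    C (algebraMap ℚ Coef (LinearMap.trace ℚ V (ρ σ))) * pPart σ.partition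

/-- A rooted tree with vertex set `V`, all edges being oriented towards the root: every vertex
other than the root has an edge to its parent, and following the edges leads to the root.  The
value of `parent` at the root carries no information and is fixed to be the root. -/
@[ext]
structure LabelledRootedTree (V : Type) where
  root : V
  parent : V → V
  parent_root : parent root = root
  reaches_root : ∀ v, ∃ k : ℕ, parent^[k] v = root

theorem relabel_iterate {V : Type} (σ : Equiv.Perm V) (f : V → V) (k : ℕ) (v : V) :
    (fun w => σ (f (σ.symm w)))^[k] v = σ (f^[k] (σ.symm v)) := by
  induction k with
  | zero => simp
  | succ k ih => rw [Function.iterate_succ_apply', Function.iterate_succ_apply', ih]; simp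

/-- Relabelling the vertices of a rooted tree. -/
def LabelledRootedTree.relabel {V : Type} (σ : Equiv.Perm V) (T : LabelledRootedTree V) : LabelledRootedTree V where
  root := σ T.root
  parent v := σ (T.parent (σ.symm v))
  parent_root := by simp [T.parent_root]
  reaches_root v := by
    obtain ⟨k, hk⟩ := T.reaches_root (σ.symm v)
    exact ⟨k, by rw [relabel_iterate, hk]⟩

/-- Permutations of the vertices act on rooted trees by relabelling. -/
instance rootedTreeAction (V : Type) : MulAction (Equiv.Perm V) (LabelledRootedTree V) where
  smul σ T := T.relabel σ
  one_smul _ := rfl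
  mul_smul _ _ _ := rfl

/-- The symmetric function `PreLie` of rooted trees: the sum over `n` of the Frobenius
characteristics of the permutation representations spanned by the rooted trees on `n` labelled
vertices. -/
def symPreLie : SymFn :=
  formalSum fun n : ℕ =>
    frobeniusChar (Representation.ofMulAction ℚ (Equiv.Perm (Fin n)) (LabelledRootedTree (Fin n)))

/-! ## Fixed points of powers of a permutation of given cycle type -/

theorem exists_perm_of_type {n : ℕ} (μ : n.Partition) :
    ∃ σ : Equiv.Perm (Fin n), σ.partition.parts = μ.parts := by
  classical
  have hsplit : μ.parts.filter (2 ≤ ·) + Multiset.replicate (μ.parts.count 1) 1 = μ.parts := by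
    conv_rhs => rw [← Multiset.filter_add_not (2 ≤ ·) μ.parts]
    congr 1
    rw [← Multiset.filter_eq']
    refine Multiset.filter_congr fun a ha => ?_
    have := μ.parts_pos ha
    omega
  have hsum : (μ.parts.filter (2 ≤ ·)).sum + μ.parts.count 1 = n := by
    have h := congrArg Multiset.sum hsplit
    simpa [μ.parts_sum] using h
  obtain ⟨σ, hσ⟩ := (Equiv.Perm.exists_with_cycleType_iff (Fin n)
    (m := μ.parts.filter (2 ≤ ·))).2 ⟨by simp; omega, fun a ha => (Multiset.mem_filter.1 ha).2⟩
  refine ⟨σ, ?_⟩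
  rw [Equiv.Perm.parts_partition, ← Equiv.Perm.sum_cycleType, hσ]
  conv_rhs => rw [← hsplit]
  congr 2
  simp; omega

/-- A permutation of cycle type `μ`. -/
def permOfType {n : ℕ} (μ : n.Partition) : Equiv.Perm (Fin n) :=
  (exists_perm_of_type μ).choose

/-- The number of fixed points of the `k`-th power of a permutation of cycle type `μ`. -/
def fixPow {n : ℕ} (μ : n.Partition) (k : ℕ) : ℕ :=
  Nat.card {i : Fin n // (permOfType μ ^ k) i = i}

/-- The number of fixed points does not depend on the permutation of cycle type `μ`. -/
theorem fixPow_eq {n : ℕ} (μ : n.Partition) (k : ℕ) (σ : Equiv.Perm (Fin n))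
    (hσ : σ.partition.parts = μ.parts) :
    fixPow μ k = Nat.card {i : Fin n // (σ ^ k) i = i} := by
  have h : (permOfType μ).partition = σ.partition :=
    Nat.Partition.ext ((exists_perm_of_type μ).choose_spec.trans hσ.symm)
  obtain ⟨c, hc⟩ := isConj_iff.1 (Equiv.Perm.partition_eq_of_isConj.2 h)
  refine Nat.card_congr (c.subtypeEquiv fun i => ?_)
  rw [← hc, conj_pow]
  simp

/-- The number `λ_k` of parts of size `k` in the partition `μ`. -/
def mult {n : ℕ} (μ : n.Partition) (k : ℕ) : ℕ := μ.parts.count k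

/-- The coefficient of `p_μ / z_μ` in the expansion.  The product over all `k ≥ 2` may stop at
`n`, since `λ_k = 0` for `k > n` and the factor is then `1`.  Exponents that may be negative are
integers: for `λ_1 = 0` the first factor is `(-t)⁻¹`. -/
def expansionCoeff {n : ℕ} (μ : n.Partition) : Coef :=
  ((mult μ 1 : Coef) - tVar) ^ ((mult μ 1 : ℤ) - 1) *
    ∏ k ∈ Finset.Icc 2 n,
      (((fixPow μ k : Coef) - tVar ^ k) ^ mult μ k -
        (k : Coef) * (mult μ k : Coef) *
          ((fixPow μ k : Coef) - tVar ^ k) ^ ((mult μ k : ℤ) - 1))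

end

/-!
The argument runs through the series `F u` whose coefficient at `∏ k, p_k ^ d k` is
`∏ k, A k (d k) (u k + properLoad k d)`, where `A k n x = x (x + k n) ^ (n - 1) / (k ^ n n!)` is an
Abel polynomial and `properLoad k d` is the sum of `j d j` over the proper divisors `j` of `k`.
Abel's binomial identity gives `F (u + v) = F u * F v`. Hence `x ↦ F (x • u)` is a one-parameter
group, and `F u` is the exponential of the part of `F (x • u)` that is linear in `x`. The factor at
the least `k` with `d k ≠ 0` vanishes at `x = 0`, since its load does; splitting off its linear term
identifies the linear part with `∑ k, (u k / k) (p_k ∘ p_1 F 1)`.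

A rooted tree fixed by `σ` is a fixed root together with a parent map commuting with `σ`, which
induces a forest on the cycles of `σ`. Cutting off the cycles whose parent is the root counts these
parent maps by the recursion that expands Abel polynomials, so that `PreLie = p_1 F 1`.

Both facts combine to `F u = exp (∑ k, (u k / k) (p_k ∘ PreLie))`, and `u k = -t ^ k` turns
`(Σ_t Comm) ∘ PreLie` into `-(1 / t) (F u - 1)`. In the coefficients of the latter the factor at
`k = 1` contributes `(λ_1 - t) ^ (λ_1 - 1)`, because `1` has no proper divisor.
-/

noncomputable section

open Finset.HasAntidiagonal (antidiagonal mem_antidiagonal)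

section Abel

variable {K : Type*} [Field K]

/-- The normalised Abel polynomial `X (X + k n) ^ (n - 1) / (k ^ n n!)` of degree `n`. -/
def abelPoly (k : K) : ℕ → Polynomial K
  | 0 => 1
  | n + 1 => .C (k ^ (n + 1) * (n + 1).factorial)⁻¹ * (.X * (.X + .C (k * (n + 1))) ^ n)

theorem abelPoly_zero (k : K) : abelPoly k 0 = 1 := rfl

theorem eval_abelPoly_succ (k x : K) (n : ℕ) :
    (abelPoly k (n + 1)).eval x =
      (k ^ (n + 1) * (n + 1).factorial)⁻¹ * (x * (x + k * (n + 1)) ^ n) := by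
  simp [abelPoly]

theorem eval_zero_abelPoly (k : K) {n : ℕ} (hn : n ≠ 0) : (abelPoly k n).eval 0 = 0 := by
  obtain ⟨m, rfl⟩ := Nat.exists_eq_succ_of_ne_zero hn
  rw [eval_abelPoly_succ, zero_mul, mul_zero]

theorem eval_mul_abelPoly {k : K} (hk : k ≠ 0) (j x : K) (n : ℕ) :
    (abelPoly (k * j) n).eval (k * x) = (abelPoly j n).eval x := by
  cases n with
  | zero => simp [abelPoly_zero]
  | succ n =>
    rw [eval_abelPoly_succ, eval_abelPoly_succ, mul_assoc k j, ← mul_add, mul_pow, mul_pow,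
      pow_succ']
    field_simp

variable [CharZero K]

theorem derivative_abelPoly_succ (k : K) (n : ℕ) :
    (abelPoly k (n + 1)).derivative = .C k⁻¹ * (abelPoly k n).comp (.X + .C k) := by
  cases n with
  | zero => simp [abelPoly]
  | succ n =>
    have hn : ((n : K) + 1 + 1) ≠ 0 := by exact_mod_cast (n + 1).succ_ne_zero
    have hconst : (k ^ (n + 2) * (n + 2).factorial)⁻¹ * (n + 2) =
        k⁻¹ * (k ^ (n + 1) * (n + 1).factorial)⁻¹ := by
      rw [Nat.factorial_succ (n + 1), pow_succ k (n + 1)]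
      push_cast
      rw [show (n : K) + 2 = n + 1 + 1 by ring]
      simp only [mul_inv]
      field_simp
    refine Polynomial.funext fun x => ?_
    simp only [abelPoly, Polynomial.derivative_mul, Polynomial.derivative_C,
      Polynomial.derivative_X, Polynomial.derivative_pow, Polynomial.derivative_add,
      Polynomial.eval_mul, Polynomial.eval_add, Polynomial.eval_pow, Polynomial.eval_C,
      Polynomial.eval_X, Polynomial.eval_comp, zero_mul, zero_add, one_mul, add_zero, mul_one,
      Nat.add_sub_cancel]
    rw [← mul_assoc k⁻¹, ← hconst]
    push_cast
    ring

theorem coeff_one_abelPoly_succ (k : K) (n : ℕ) :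
    (abelPoly k (n + 1)).coeff 1 = k⁻¹ * (abelPoly k n).eval k := by
  have h := congrArg (Polynomial.eval 0) (derivative_abelPoly_succ k n)
  rw [← Polynomial.coeff_zero_eq_eval_zero, Polynomial.coeff_derivative] at h
  simpa using h

theorem polynomial_eq_of_derivative_eq {p q : Polynomial K} (h : p.derivative = q.derivative)
    (h0 : p.eval 0 = q.eval 0) : p = q := by
  rw [← sub_eq_zero, ← Polynomial.derivative_sub] at h
  rw [← sub_eq_zero, ← Polynomial.eval_sub, ← Polynomial.coeff_zero_eq_eval_zero] at h0
  rw [← sub_eq_zero, Polynomial.eq_C_of_derivative_eq_zero h, h0, map_zero]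

theorem derivative_abelPoly_succ_comp (k e : K) (n : ℕ) :
    ((abelPoly k (n + 1)).comp (.X + .C e)).derivative =
      .C k⁻¹ * (abelPoly k n).comp (.X + .C (k + e)) := by
  simp [Polynomial.derivative_comp, derivative_abelPoly_succ, Polynomial.comp_assoc,
    add_left_comm, add_comm]

theorem abelPoly_comp_add_eq_sum_pow (k e : K) (n : ℕ) :
    (abelPoly k n).comp (.X + .C e) = ∑ p ∈ antidiagonal n,
      .C ((k ^ p.1 * p.1.factorial)⁻¹ * (abelPoly k p.2).eval (k * p.1 + e)) * .X ^ p.1 := by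
  induction n generalizing e with
  | zero => simp [abelPoly_zero]
  | succ n ih =>
    refine polynomial_eq_of_derivative_eq ?_ ?_
    · rw [derivative_abelPoly_succ_comp, ih, Finset.Nat.sum_antidiagonal_succ,
        Polynomial.derivative_add, Polynomial.derivative_sum, Finset.mul_sum,
        Polynomial.derivative_C_mul_X_pow, Nat.cast_zero, mul_zero, map_zero, zero_mul, zero_add]
      refine Finset.sum_congr rfl fun p _ => ?_
      have hp : (p.1 : K) + 1 ≠ 0 := by exact_mod_cast p.1.succ_ne_zero
      rw [Polynomial.derivative_C_mul_X_pow, ← mul_assoc, ← Polynomial.C_mul, Nat.add_sub_cancel,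
        Nat.factorial_succ]
      push_cast
      congr 2
      rw [show k * ((p.1 : K) + 1) + e = k * p.1 + (k + e) by ring]
      simp only [pow_succ, mul_inv]
      field_simp
    · rw [Finset.Nat.sum_antidiagonal_succ]
      simp [Polynomial.eval_finsetSum]

theorem eval_add_abelPoly_eq_sum_pow (k x e : K) (n : ℕ) :
    (abelPoly k n).eval (x + e) = ∑ p ∈ antidiagonal n,
      (k ^ p.1 * p.1.factorial)⁻¹ * (abelPoly k p.2).eval (k * p.1 + e) * x ^ p.1 := by
  simpa [Polynomial.eval_finsetSum] using
    congrArg (Polynomial.eval x) (abelPoly_comp_add_eq_sum_pow k e n)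

theorem abelPoly_comp_add_eq_sum_mul (k y : K) (n : ℕ) :
    (abelPoly k n).comp (.X + .C y) =
      ∑ p ∈ antidiagonal n, abelPoly k p.1 * .C ((abelPoly k p.2).eval y) := by
  induction n with
  | zero => simp [abelPoly_zero]
  | succ n ih =>
    refine polynomial_eq_of_derivative_eq ?_ ?_
    · have hshift : (abelPoly k n).comp (.X + .C (k + y)) =
          ((abelPoly k n).comp (.X + .C y)).comp (.X + .C k) := by
        simp [Polynomial.comp_assoc, add_assoc]
      rw [derivative_abelPoly_succ_comp, hshift, ih, Finset.Nat.sum_antidiagonal_succ,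
        Polynomial.derivative_add, Polynomial.derivative_sum, Polynomial.sum_comp,
        Finset.mul_sum, abelPoly_zero, one_mul, Polynomial.derivative_C, zero_add]
      refine Finset.sum_congr rfl fun p _ => ?_
      rw [Polynomial.derivative_mul, Polynomial.derivative_C, mul_zero, add_zero,
        derivative_abelPoly_succ, Polynomial.mul_comp,
        Polynomial.C_comp, mul_assoc]
    · rw [Finset.Nat.sum_antidiagonal_succ]
      simp [Polynomial.eval_finsetSum, abelPoly_zero, eval_zero_abelPoly]

theorem eval_add_abelPoly_eq_sum_mul (k x y : K) (n : ℕ) :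
    (abelPoly k n).eval (x + y) =
      ∑ p ∈ antidiagonal n, (abelPoly k p.1).eval x * (abelPoly k p.2).eval y := by
  simpa [Polynomial.eval_finsetSum] using
    congrArg (Polynomial.eval x) (abelPoly_comp_add_eq_sum_mul k y n)

end Abel

section Weights

/-- For the exponent `d` that records `d j` cycles of each length `j`, the number of points on the
cycles whose length divides `k`: the points fixed by the `k`-th power of the permutation. -/
def fixedLoad (k : ℕ+) : (ℕ+ →₀ ℕ) →+ ℕ :=
  Finsupp.weight fun j : ℕ+ => if (j : ℕ) ∣ k then (j : ℕ) else 0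

/-- The number of points on the cycles whose length is a proper divisor of `k`. -/
def properLoad (k : ℕ+) : (ℕ+ →₀ ℕ) →+ ℕ :=
  Finsupp.weight fun j : ℕ+ => if (j : ℕ) ∣ k ∧ j ≠ k then (j : ℕ) else 0

theorem fixedLoad_eq (k : ℕ+) (d : ℕ+ →₀ ℕ) : fixedLoad k d = k * d k + properLoad k d := by
  have h : fixedLoad k = (k : ℕ) • Finsupp.applyAddHom k + properLoad k := by
    refine Finsupp.addHom_ext fun j n => ?_
    rcases eq_or_ne j k with rfl | hj
    · simp [fixedLoad, properLoad, Finsupp.weight_single, mul_comm]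
    · simp [fixedLoad, properLoad, Finsupp.weight_single, hj]
  simp [h]

theorem properLoad_eq_zero {k : ℕ+} {d : ℕ+ →₀ ℕ} (h : ∀ j ∈ d.support, (j : ℕ) ∣ k → k ≤ j) :
    properLoad k d = 0 := by
  rw [properLoad, Finsupp.weight_apply]
  refine Finset.sum_eq_zero fun j hj => ?_
  dsimp only
  rw [if_neg, smul_zero]
  rintro ⟨hdvd, hne⟩
  exact hne (le_antisymm (Nat.le_of_dvd k.pos hdvd) (h j hj hdvd))

theorem properLoad_single_of_le {k j : ℕ+} (h : k ≤ j) (n : ℕ) :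
    properLoad k (Finsupp.single j n) = 0 :=
  properLoad_eq_zero fun i hi _ => by
    rwa [Finset.mem_singleton.1 (Finsupp.support_single_subset hi)]

end Weights

section ForestSeries

variable {K : Type*} [Field K]

/-- The series with `∏ k, abelPoly k (d k) (u k + properLoad k d)` as coefficient of the monomial
`p ^ d`. It counts the forests fixed by a permutation of cycle type `d` whose trees are grafted on
fixed points of its powers, `u k` being the number of points fixed by the `k`-th power. -/
def forestSeries (u : ℕ+ → K) : MvPowerSeries ℕ+ K := fun d =>
  ∏ k ∈ d.support, (abelPoly ((k : ℕ) : K) (d k)).eval (u k + properLoad k d)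

theorem coeff_forestSeries (u : ℕ+ → K) (d : ℕ+ →₀ ℕ) :
    coeff d (forestSeries u) =
      ∏ k ∈ d.support, (abelPoly ((k : ℕ) : K) (d k)).eval (u k + properLoad k d) := rfl

theorem coeff_forestSeries_of_subset (u : ℕ+ → K) (d : ℕ+ →₀ ℕ) {s : Finset ℕ+}
    (hs : d.support ⊆ s) :
    coeff d (forestSeries u) =
      ∏ k ∈ s, (abelPoly ((k : ℕ) : K) (d k)).eval (u k + properLoad k d) := by
  refine Finset.prod_subset hs fun k _ hk => ?_
  rw [Finsupp.notMem_support_iff.1 hk, abelPoly_zero, Polynomial.eval_one]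

theorem coeff_forestSeries_eq_zero {u : ℕ+ → K} {d : ℕ+ →₀ ℕ} {k : ℕ+} (hk : k ∈ d.support)
    (hu : u k = 0) (hload : properLoad k d = 0) : coeff d (forestSeries u) = 0 := by
  refine Finset.prod_eq_zero hk ?_
  rw [hu, hload, Nat.cast_zero, add_zero, eval_zero_abelPoly _ (Finsupp.mem_support_iff.1 hk)]

theorem coeff_forestSeries_single_add (u : ℕ+ → K) {a : ℕ+} (n : ℕ) {e : ℕ+ →₀ ℕ}
    (he : ∀ c ∈ e.support, c < a) :
    coeff (Finsupp.single a n + e) (forestSeries u) =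
      (abelPoly ((a : ℕ) : K) n).eval (u a + properLoad a e) * coeff e (forestSeries u) := by
  have ha : a ∉ e.support := fun h => lt_irrefl _ (he a h)
  have hsub : (Finsupp.single a n + e).support ⊆ insert a e.support := by
    refine Finsupp.support_add.trans (Finset.union_subset ?_ (Finset.subset_insert _ _))
    exact Finsupp.support_single_subset.trans (by simp)
  rw [coeff_forestSeries_of_subset u _ hsub, Finset.prod_insert ha, coeff_forestSeries]
  congr 1
  · rw [map_add, properLoad_single_of_le le_rfl, zero_add, Finsupp.add_apply,
      Finsupp.single_eq_same, Finsupp.notMem_support_iff.1 ha, add_zero]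
  · refine Finset.prod_congr rfl fun k hk => ?_
    rw [map_add, properLoad_single_of_le (he k hk).le, zero_add, Finsupp.add_apply,
      Finsupp.single_eq_of_ne (he k hk).ne, zero_add]

theorem forestSeries_zero : forestSeries (0 : ℕ+ → K) = 1 := by
  classical
  ext d
  rw [coeff_one]
  split_ifs with hd
  · simp [hd, coeff_forestSeries]
  · have hne := Finsupp.support_nonempty_iff.2 hd
    exact coeff_forestSeries_eq_zero (Finset.min'_mem _ hne) rfl
      (properLoad_eq_zero fun j hj _ => Finset.min'_le _ j hj)

theorem sum_antidiagonal_single_add {σ M : Type*} [DecidableEq σ] [AddCommMonoid M] {a : σ} (n : ℕ)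
    {e : σ →₀ ℕ} (ha : a ∉ e.support) (F : (σ →₀ ℕ) × (σ →₀ ℕ) → M) :
    ∑ p ∈ antidiagonal (Finsupp.single a n + e), F p =
      ∑ q ∈ antidiagonal e, ∑ r ∈ antidiagonal n,
        F (Finsupp.single a r.1 + q.1, Finsupp.single a r.2 + q.2) := by
  have hea := Finsupp.notMem_support_iff.1 ha
  rw [← Finset.sum_product']
  refine Finset.sum_nbij' (fun p => ((p.1.erase a, p.2.erase a), (p.1 a, p.2 a)))
    (fun q => (Finsupp.single a q.2.1 + q.1.1, Finsupp.single a q.2.2 + q.1.2)) ?_ ?_ ?_ ?_ ?_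
  · rintro ⟨x, y⟩ h
    rw [mem_antidiagonal] at h
    refine Finset.mem_product.2 ⟨mem_antidiagonal.2 ?_, mem_antidiagonal.2 ?_⟩
    · rw [← Finsupp.erase_add, h, Finsupp.erase_add, Finsupp.erase_single, zero_add,
        Finsupp.erase_of_notMem_support ha]
    · simpa [hea] using DFunLike.congr_fun h a
  · rintro ⟨⟨x, y⟩, i, j⟩ h
    simp only [Finset.mem_product, mem_antidiagonal] at h ⊢
    rw [← h.1, ← h.2, Finsupp.single_add]
    abel
  · rintro ⟨x, y⟩ -
    simp [Finsupp.single_add_erase]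
  · rintro ⟨⟨x, y⟩, i, j⟩ h
    simp only [Finset.mem_product, mem_antidiagonal] at h
    have hsum : x a + y a = 0 := by rw [← Finsupp.add_apply, h.1, hea]
    obtain ⟨hx, hy⟩ := Nat.add_eq_zero_iff.1 hsum
    simp [Finsupp.erase_add, hx, hy]
  · rintro ⟨x, y⟩ -
    simp [Finsupp.single_add_erase]

variable [CharZero K]

theorem forestSeries_add (u v : ℕ+ → K) :
    forestSeries (u + v) = forestSeries u * forestSeries v := by
  classical
  ext d
  rw [coeff_mul]
  induction d using Finsupp.induction_on_max with
  | zero => simp [coeff_forestSeries]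
  | single_add a n e he _ ih =>
    rw [sum_antidiagonal_single_add n fun h => lt_irrefl _ (he a h),
      coeff_forestSeries_single_add _ n he, ih, Finset.mul_sum]
    refine Finset.sum_congr rfl fun q hq => ?_
    rw [mem_antidiagonal] at hq
    have h1 : ∀ c ∈ q.1.support, c < a := fun c hc =>
      he c (Finsupp.support_mono (hq ▸ le_self_add) hc)
    have h2 : ∀ c ∈ q.2.support, c < a := fun c hc =>
      he c (Finsupp.support_mono (hq ▸ le_add_self) hc)
    have hload : (u + v) a + (properLoad a e : K) =
        (u a + properLoad a q.1) + (v a + properLoad a q.2) := by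
      rw [← hq, map_add, Pi.add_apply]; push_cast; ring
    rw [hload, eval_add_abelPoly_eq_sum_mul, Finset.sum_mul]
    refine Finset.sum_congr rfl fun r _ => ?_
    rw [coeff_forestSeries_single_add u _ h1, coeff_forestSeries_single_add v _ h2]
    ring

end ForestSeries

section BinomialType

variable {σ K : Type*} [DecidableEq σ] [Field K]

/-- The polynomials `P d`, indexed by multivariate exponents, are of binomial type: they vanish at
`0` for `d ≠ 0`, and their generating series turns sums of arguments into products. The factorials
of the usual binomial identity are absorbed in the `P d`. -/
structure IsBinomialType (P : (σ →₀ ℕ) → Polynomial K) : Prop where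
  zero : P 0 = 1
  eval_zero : ∀ d ≠ 0, (P d).eval 0 = 0
  eval_add : ∀ d x y, (P d).eval (x + y) = ∑ p ∈ antidiagonal d, (P p.1).eval x * (P p.2).eval y

/-- The series `∑ d, (P d).coeff m * p ^ d`, for a family of polynomials `P`. -/
def coeffSeries (P : (σ →₀ ℕ) → Polynomial K) (m : ℕ) : MvPowerSeries σ K := fun d => (P d).coeff m

omit [DecidableEq σ] in
theorem coeff_coeffSeries (P : (σ →₀ ℕ) → Polynomial K) (m : ℕ) (d : σ →₀ ℕ) :
    coeff d (coeffSeries P m) = (P d).coeff m := rfl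

namespace IsBinomialType

variable {P : (σ →₀ ℕ) → Polynomial K}

theorem coeffSeries_zero (hP : IsBinomialType P) : coeffSeries P 0 = 1 := by
  ext d
  rw [coeff_coeffSeries, coeff_one, Polynomial.coeff_zero_eq_eval_zero]
  split_ifs with hd
  · rw [hd, hP.zero, Polynomial.eval_one]
  · exact hP.eval_zero d hd

theorem constantCoeff_coeffSeries_one (hP : IsBinomialType P) :
    constantCoeff (coeffSeries P 1) = 0 := by
  rw [← coeff_zero_eq_constantCoeff_apply, coeff_coeffSeries, hP.zero, Polynomial.coeff_one,
    if_neg one_ne_zero]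

variable [CharZero K]

theorem comp_add (hP : IsBinomialType P) (d : σ →₀ ℕ) (x : K) :
    (P d).comp (.C x + .X) = ∑ p ∈ antidiagonal d, .C ((P p.1).eval x) * P p.2 := by
  refine Polynomial.funext fun y => ?_
  simpa [Polynomial.eval_finsetSum] using hP.eval_add d x y

theorem derivative_eq (hP : IsBinomialType P) (d : σ →₀ ℕ) :
    (P d).derivative = ∑ p ∈ antidiagonal d, P p.1 * .C ((P p.2).coeff 1) := by
  refine Polynomial.funext fun x => ?_
  have h := congrArg (fun q => q.derivative.eval 0) (hP.comp_add d x)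
  have hcoeff : ∀ q : Polynomial K, q.derivative.eval 0 = q.coeff 1 := fun q => by
    simp [← Polynomial.coeff_zero_eq_eval_zero, Polynomial.coeff_derivative]
  simpa [Polynomial.derivative_comp, Polynomial.derivative_sum, Polynomial.eval_finsetSum,
    hcoeff] using h

theorem coeffSeries_succ (hP : IsBinomialType P) (m : ℕ) :
    ((m : K) + 1) • coeffSeries P (m + 1) = coeffSeries P m * coeffSeries P 1 := by
  ext d
  have h := congrArg (fun q => q.coeff m) (hP.derivative_eq d)
  simp only [Polynomial.coeff_derivative, Polynomial.finsetSum_coeff,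
    Polynomial.coeff_mul_C] at h
  rw [coeff_smul, coeff_mul, coeff_coeffSeries, mul_comm, h]
  rfl

theorem coeffSeries_eq_pow (hP : IsBinomialType P) (m : ℕ) :
    coeffSeries P m = (m.factorial : K)⁻¹ • coeffSeries P 1 ^ m := by
  induction m with
  | zero => simp [hP.coeffSeries_zero]
  | succ m ih =>
    have hm : (m : K) + 1 ≠ 0 := by exact_mod_cast m.succ_ne_zero
    rw [(eq_inv_smul_iff₀ hm).2 (hP.coeffSeries_succ m), ih, smul_mul_assoc, smul_smul, ← pow_succ,
      Nat.factorial_succ, Nat.cast_mul, mul_inv, Nat.cast_add_one]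

/-- The `P d` are the coefficients of the one-parameter group `x ↦ exp (x • coeffSeries P 1)`. -/
theorem coeff_exp_subst_coeffSeries_one [Algebra ℚ K] (hP : IsBinomialType P) (d : σ →₀ ℕ) :
    coeff d ((PowerSeries.exp K).subst (coeffSeries P 1)) = (P d).eval 1 := by
  have hterm : ∀ m : ℕ, PowerSeries.coeff m (PowerSeries.exp K) • coeff d (coeffSeries P 1 ^ m) =
      (P d).coeff m := fun m => by
    rw [← coeff_coeffSeries, hP.coeffSeries_eq_pow m, coeff_smul, PowerSeries.coeff_exp]
    simp
  rw [PowerSeries.coeff_subst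
    (PowerSeries.HasSubst.of_constantCoeff_zero hP.constantCoeff_coeffSeries_one)]
  simp_rw [hterm]
  rw [finsum_eq_sum_of_support_subset (s := (P d).support) _ fun m hm => by simpa using hm,
    Polynomial.eval_eq_sum, Polynomial.sum]
  simp

end IsBinomialType

end BinomialType

section ForestPolynomial

variable {K : Type*} [Field K]

/-- The coefficient of `p ^ d` in `forestSeries (x • u)`, as a polynomial in `x`. -/
def forestPoly (u : ℕ+ → K) (d : ℕ+ →₀ ℕ) : Polynomial K :=
  ∏ k ∈ d.support, (abelPoly ((k : ℕ) : K) (d k)).comp (.C (u k) * .X + .C (properLoad k d : K))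

theorem eval_forestPoly (u : ℕ+ → K) (d : ℕ+ →₀ ℕ) (x : K) :
    (forestPoly u d).eval x = coeff d (forestSeries (x • u)) := by
  simp [forestPoly, coeff_forestSeries, Polynomial.eval_prod, mul_comm x]

theorem isBinomialType_forestPoly [CharZero K] (u : ℕ+ → K) : IsBinomialType (forestPoly u) where
  zero := by simp [forestPoly]
  eval_zero d hd := by
    rw [eval_forestPoly, zero_smul, forestSeries_zero, coeff_one, if_neg hd]
  eval_add d x y := by
    simp_rw [eval_forestPoly]
    rw [add_smul, forestSeries_add, coeff_mul]

end ForestPolynomial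

section TreeSeries

variable {K : Type*} [Field K]

variable (K) in
/-- The series of the forests fixed by a permutation that permutes their roots cyclically, the
cycle of the roots being of length `k` and included in the cycle type. -/
def treeSeries (k : ℕ+) : MvPowerSeries ℕ+ K :=
  X k * forestSeries fun j => (fixedLoad j (Finsupp.single k 1) : K)

theorem fixedLoad_single (k j : ℕ+) (n : ℕ) :
    fixedLoad k (Finsupp.single j n) = if (j : ℕ) ∣ k then n * (j : ℕ) else 0 := by
  simp [fixedLoad, Finsupp.weight_single]

theorem properLoad_single_add {k a : ℕ+} (hka : k ≠ a) (e : ℕ+ →₀ ℕ) :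
    properLoad k (Finsupp.single a 1 + e) =
      fixedLoad k (Finsupp.single a 1) + properLoad k e := by
  rw [map_add, fixedLoad_eq, Finsupp.single_eq_of_ne hka, mul_zero, zero_add]

theorem coeff_single_add_treeSeries (a : ℕ+) (e : ℕ+ →₀ ℕ) :
    coeff (Finsupp.single a 1 + e) (treeSeries K a) =
      coeff e (forestSeries fun j => (fixedLoad j (Finsupp.single a 1) : K)) := by
  rw [treeSeries, X_def, coeff_add_monomial_mul, one_mul]

theorem coeff_treeSeries_eq_zero {k a : ℕ+} {d : ℕ+ →₀ ℕ} (ha : a ∈ d.support)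
    (hmin : ∀ j ∈ d.support, a ≤ j) (hka : k ≠ a) : coeff d (treeSeries K k) = 0 := by
  rw [treeSeries, X_def, coeff_monomial_mul, one_mul]
  split_ifs with hk
  · have hmem : k ∈ d.support := Finsupp.mem_support_iff.2
      (Nat.one_le_iff_ne_zero.1 (by simpa using hk k))
    have hlt : a < k := lt_of_le_of_ne (hmin k hmem) hka.symm
    refine coeff_forestSeries_eq_zero (k := a) ?_ ?_ (properLoad_eq_zero fun j hj _ => ?_)
    · simpa [Finsupp.single_eq_of_ne hka.symm] using ha
    · have hdvd : ¬ (k : ℕ) ∣ a := fun h => hlt.not_ge (Nat.le_of_dvd a.pos h)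
      rw [fixedLoad_single, if_neg hdvd, Nat.cast_zero]
    · exact hmin j (Finsupp.support_mono tsub_le_self hj)
  · rfl

variable [CharZero K]

theorem coeff_one_forestPoly_single_add (u : ℕ+ → K) {a : ℕ+} {e : ℕ+ →₀ ℕ}
    (ha : ∀ j ∈ e.support, a ≤ j) :
    (forestPoly u (Finsupp.single a 1 + e)).coeff 1 =
      u a / ((a : ℕ) : K) *
        coeff e (forestSeries fun j => (fixedLoad j (Finsupp.single a 1) : K)) := by
  set d := Finsupp.single a 1 + e with hd
  have hda : d a = e a + 1 := by simp [hd, add_comm]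
  have hmem : a ∈ d.support := by simp [hda]
  have hload : properLoad a e = 0 := properLoad_eq_zero fun j hj _ => ha j hj
  have hload' : properLoad a d = 0 := by rw [hd, map_add, properLoad_single_of_le le_rfl, hload]
  have hroot : ∀ n, (abelPoly ((a : ℕ) : K) (n + 1)).comp
      (.C (u a) * .X + .C (properLoad a d : K)) =
        (abelPoly ((a : ℕ) : K) (n + 1)).comp (.C (u a) * .X) := fun n => by
    rw [hload', Nat.cast_zero, map_zero, add_zero]
  have hrest : (∏ k ∈ d.support.erase a, (abelPoly ((k : ℕ) : K) (d k)).comp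
      (.C (u k) * .X + .C (properLoad k d : K))).coeff 0 = ∏ k ∈ d.support.erase a,
        (abelPoly ((k : ℕ) : K) (e k)).eval
          ((fixedLoad k (Finsupp.single a 1) : K) + properLoad k e) := by
    rw [Polynomial.coeff_zero_eq_eval_zero, Polynomial.eval_prod]
    refine Finset.prod_congr rfl fun k hk => ?_
    have hka := Finset.ne_of_mem_erase hk
    have hdk : d k = e k := by simp [hd, Finsupp.single_eq_of_ne hka]
    rw [hdk, hd, properLoad_single_add hka]
    simp
  rw [coeff_forestSeries_of_subset _ e (s := d.support) (Finsupp.support_mono (hd ▸ le_add_self)),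
    forestPoly, ← Finset.mul_prod_erase _ _ hmem, ← Finset.mul_prod_erase _ _ hmem,
    Polynomial.mul_coeff_one, hrest, hda, hroot, Polynomial.comp_C_mul_X_coeff,
    Polynomial.comp_C_mul_X_coeff, Polynomial.coeff_zero_eq_eval_zero,
    eval_zero_abelPoly _ (Nat.succ_ne_zero _), coeff_one_abelPoly_succ, hload, fixedLoad_single]
  simp only [if_pos dvd_rfl, Nat.cast_zero, zero_mul, zero_add, pow_one, one_mul, add_zero]
  ring

theorem coeff_coeffSeries_one_forestPoly (u : ℕ+ → K) (d : ℕ+ →₀ ℕ) :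
    coeff d (coeffSeries (forestPoly u) 1) =
      ∑ᶠ k : ℕ+, u k / ((k : ℕ) : K) * coeff d (treeSeries K k) := by
  rcases eq_or_ne d 0 with rfl | hd
  · rw [coeff_zero_eq_constantCoeff_apply,
      (isBinomialType_forestPoly u).constantCoeff_coeffSeries_one]
    simp [treeSeries]
  obtain ⟨a, ha, hmin⟩ : ∃ a ∈ d.support, ∀ j ∈ d.support, a ≤ j :=
    ⟨_, Finset.min'_mem _ (Finsupp.support_nonempty_iff.2 hd), fun j hj => Finset.min'_le _ j hj⟩
  rw [finsum_eq_single _ a fun k hka => by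
    rw [coeff_treeSeries_eq_zero ha hmin hka, mul_zero]]
  obtain ⟨e, rfl⟩ : ∃ e, d = Finsupp.single a 1 + e := exists_add_of_le
    (Finsupp.single_le_iff.2 (Nat.one_le_iff_ne_zero.2 (Finsupp.mem_support_iff.1 ha)))
  rw [coeff_coeffSeries, coeff_single_add_treeSeries, coeff_one_forestPoly_single_add u fun j hj =>
    hmin j (Finsupp.support_mono le_add_self hj)]

end TreeSeries

section Adams

variable {K L : Type*} [Field K] [Field L]

theorem map_abelPoly_eval (φ : K →+* L) (k x : K) (n : ℕ) :
    φ ((abelPoly k n).eval x) = (abelPoly (φ k) n).eval (φ x) := by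
  cases n with
  | zero => simp [abelPoly_zero]
  | succ n => simp [eval_abelPoly_succ]

theorem map_forestSeries (φ : K →+* L) (u : ℕ+ → K) :
    MvPowerSeries.map φ (forestSeries u) = forestSeries (φ ∘ u) := by
  ext d
  simp [coeff_forestSeries, map_abelPoly_eval]

theorem map_treeSeries (φ : K →+* L) (k : ℕ+) :
    MvPowerSeries.map φ (treeSeries K k) = treeSeries L k := by
  rw [treeSeries, map_mul, map_X, map_forestSeries, treeSeries]
  simp [Function.comp_def]

theorem adams_eq_rename (k : ℕ+) (g : SymFn) :
    adams k g = rename (mulLeftEmbedding k) (MvPowerSeries.map (coefAdams k) g) := by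
  rw [rename_eq_subst]
  rfl

theorem properLoad_embDomain (k j : ℕ+) (e : ℕ+ →₀ ℕ) :
    properLoad (k * j) (e.embDomain (mulLeftEmbedding k)) = k * properLoad j e := by
  rw [properLoad, properLoad, Finsupp.weight_apply, Finsupp.weight_apply, Finsupp.sum_embDomain,
    Finsupp.sum, Finsupp.sum, Finset.mul_sum]
  refine Finset.sum_congr rfl fun i _ => ?_
  simp only [mulLeftEmbedding_apply, PNat.mul_coe, Nat.mul_dvd_mul_iff_left k.pos, ne_eq,
    mul_right_inj, smul_eq_mul, mul_ite, mul_zero, mul_left_comm]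

theorem coeff_fixedLoad_forestSeries_eq_zero {k : ℕ+} {d : ℕ+ →₀ ℕ}
    (h : ∃ b ∈ d.support, ¬ (k : ℕ) ∣ b) :
    coeff d (forestSeries fun j => (fixedLoad j (Finsupp.single k 1) : K)) = 0 := by
  classical
  have hne : (d.support.filter fun b : ℕ+ => ¬ (k : ℕ) ∣ b).Nonempty :=
    h.imp fun b hb => Finset.mem_filter.2 hb
  obtain ⟨hb, hkb⟩ := Finset.mem_filter.1 (Finset.min'_mem _ hne)
  refine coeff_forestSeries_eq_zero hb (by rw [fixedLoad_single, if_neg hkb, Nat.cast_zero])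
    (properLoad_eq_zero fun j hj hjb => Finset.min'_le _ j ?_)
  exact Finset.mem_filter.2 ⟨hj, fun hkj => hkb (hkj.trans hjb)⟩

variable [CharZero K]

theorem rename_forestSeries_one (k : ℕ+) :
    rename (mulLeftEmbedding k)
        (forestSeries fun j => (fixedLoad j (Finsupp.single 1 1) : K)) =
      forestSeries fun j => (fixedLoad j (Finsupp.single k 1) : K) := by
  ext d
  by_cases hd : d ∈ Set.range (Finsupp.embDomain (mulLeftEmbedding k))
  · obtain ⟨e, rfl⟩ := hd
    rw [coeff_embDomain_rename, coeff_forestSeries, coeff_forestSeries, Finsupp.support_embDomain,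
      Finset.prod_map]
    refine Finset.prod_congr rfl fun j _ => ?_
    have hk : ((k : ℕ) : K) ≠ 0 := Nat.cast_ne_zero.2 k.ne_zero
    rw [Finsupp.embDomain_apply_self, mulLeftEmbedding_apply, properLoad_embDomain,
      ← eval_mul_abelPoly hk]
    simp [fixedLoad_single, mul_add]
  · have hrange : d ∉ Set.range (Finsupp.mapDomain (mulLeftEmbedding k)) := by
      rwa [← funext fun e => Finsupp.embDomain_eq_mapDomain (mulLeftEmbedding k) e]
    rw [coeff_rename_eq_zero _ _ hrange, coeff_fixedLoad_forestSeries_eq_zero]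
    rw [Finsupp.mem_range_embDomain_iff, Set.not_subset] at hd
    obtain ⟨b, hb, hkb⟩ := hd
    exact ⟨b, hb, fun h => hkb ((PNat.dvd_iff.2 h).imp fun _ => Eq.symm)⟩

theorem rename_treeSeries_one (k : ℕ+) :
    rename (mulLeftEmbedding k) (treeSeries K 1) = treeSeries K k := by
  rw [treeSeries, map_mul, rename_X, rename_forestSeries_one, mulLeftEmbedding_apply, mul_one,
    treeSeries]

theorem adams_treeSeries_one (k : ℕ+) : adams k (treeSeries Coef 1) = treeSeries Coef k := by
  rw [adams_eq_rename, map_treeSeries, rename_treeSeries_one]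

end Adams

section Plethysm

theorem constantCoeff_adams (k : ℕ+) (g : SymFn) :
    constantCoeff (adams k g) = coefAdams k (constantCoeff g) := by
  rw [adams_eq_rename, constantCoeff_rename, constantCoeff_map]

theorem dvd_of_coeff_adams_ne_zero {k : ℕ+} {g : SymFn} {d : ℕ+ →₀ ℕ}
    (h : coeff d (adams k g) ≠ 0) {j : ℕ+} (hj : j ∈ d.support) : k ∣ j := by
  rw [adams_eq_rename] at h
  have hd := not_imp_comm.1 (coeff_rename_eq_zero (mulLeftEmbedding k) _) h
  rw [← funext fun e => Finsupp.embDomain_eq_mapDomain (mulLeftEmbedding k) e,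
    Finsupp.mem_range_embDomain_iff] at hd
  exact (hd hj).imp fun _ => Eq.symm

theorem hasSubst_smul_adams (c : ℕ+ → Coef) {g : SymFn} (hg : constantCoeff g = 0) :
    HasSubst fun k : ℕ+ => c k • adams k g where
  const_coeff k := by
    rw [smul_eq_C_mul, map_mul, constantCoeff_adams, hg, map_zero, mul_zero]
    exact IsNilpotent.zero
  coeff_zero d := by
    have hsupp : ∀ k, coeff d (c k • adams k g) ≠ 0 → coeff d (adams k g) ≠ 0 := fun k =>
      mt fun h => by rw [coeff_smul, h, mul_zero]
    rcases eq_or_ne d 0 with rfl | hd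
    · refine Set.Finite.subset Set.finite_empty fun k hk => hsupp k hk ?_
      rw [coeff_zero_eq_constantCoeff_apply, constantCoeff_adams, hg, map_zero]
    · obtain ⟨j, hj⟩ := Finsupp.support_nonempty_iff.2 hd
      exact (Set.finite_Icc 1 j).subset fun k hk =>
        ⟨one_le, PNat.le_of_dvd (dvd_of_coeff_adams_ne_zero (hsupp k hk) hj)⟩

/-- The series `∑ k, p_k / k`, whose exponential is `1 + Comm`. -/
def powerSumLog : SymFn := formalSum fun k : ℕ+ => C (1 / ((k : ℕ) : Coef)) * pSum k

theorem coeff_powerSumLog (d : ℕ+ →₀ ℕ) :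
    coeff d powerSumLog = ∑ᶠ k : ℕ+, coeff d (C (1 / ((k : ℕ) : Coef)) * pSum k) := rfl

theorem coeff_powerSumLog_single (k : ℕ+) :
    coeff (Finsupp.single k 1) powerSumLog = 1 / ((k : ℕ) : Coef) := by
  classical
  rw [coeff_powerSumLog, finsum_eq_single _ k fun j hj => ?_]
  · rw [coeff_C_mul, pSum, coeff_X, if_pos rfl, mul_one]
  · rw [coeff_C_mul, pSum, coeff_X, if_neg, mul_zero]
    exact fun h => hj (Finsupp.single_left_injective one_ne_zero h).symm

theorem coeff_powerSumLog_of_ne {d : ℕ+ →₀ ℕ} (hd : ∀ k, d ≠ Finsupp.single k 1) :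
    coeff d powerSumLog = 0 := by
  classical
  rw [coeff_powerSumLog]
  refine finsum_eq_zero_of_forall_eq_zero fun k => ?_
  rw [coeff_C_mul, pSum, coeff_X, if_neg (hd k), mul_zero]

theorem hasSubst_powerSumLog : PowerSeries.HasSubst powerSumLog :=
  .of_constantCoeff_zero (coeff_powerSumLog_of_ne (d := 0) fun k => by simp [eq_comm])

theorem coeff_subst_powerSumLog {a : ℕ+ → SymFn} (ha : HasSubst a) (d : ℕ+ →₀ ℕ) :
    coeff d (subst a powerSumLog) = ∑ᶠ k : ℕ+, 1 / ((k : ℕ) : Coef) * coeff d (a k) := by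
  have hinj : Function.Injective fun k : ℕ+ => (Finsupp.single k 1 : ℕ+ →₀ ℕ) :=
    Finsupp.single_left_injective one_ne_zero
  have hsupp : Function.support (fun e : ℕ+ →₀ ℕ =>
      coeff e powerSumLog • coeff d (e.prod fun s n => a s ^ n)) ⊆
        Set.range fun k : ℕ+ => Finsupp.single k 1 := fun e he => by
    by_contra h
    refine he ?_
    dsimp only
    rw [coeff_powerSumLog_of_ne fun k hk => h ⟨k, hk.symm⟩, zero_smul]
  rw [coeff_subst ha, ← Set.indicator_eq_self.2 hsupp, ← finsum_mem_def, finsum_mem_range hinj]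
  refine finsum_congr fun k => ?_
  rw [coeff_powerSumLog_single, Finsupp.prod_single_index (h := fun s n => a s ^ n)
    (pow_zero _), pow_one, smul_eq_mul]

theorem plethysm_suspension_symComm {g : SymFn} (hg : constantCoeff g = 0) :
    plethysm (suspension symComm) g = C (-(1 / tVar)) *
      ((PowerSeries.exp Coef).subst
        (subst (fun k : ℕ+ => (-tVar ^ (k : ℕ)) • adams k g) powerSumLog) - 1) := by
  have ha : HasSubst fun k : ℕ+ => adams k g := by
    simpa only [one_smul] using hasSubst_smul_adams (fun _ => 1) hg
  have hrescale : HasSubst ((fun k : ℕ+ => -tVar ^ (k : ℕ)) • (X : ℕ+ → SymFn)) := .smul_X _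
  have hC : ∀ c : Coef, subst (fun k : ℕ+ => adams k g) (C c : SymFn) = C c := fun c => subst_C c
  have hone : subst (fun k : ℕ+ => adams k g) (1 : SymFn) = 1 := by simpa using hC 1
  have hcomp : (fun k : ℕ+ => subst (fun k : ℕ+ => adams k g)
      (((fun k : ℕ+ => -tVar ^ (k : ℕ)) • (X : ℕ+ → SymFn)) k)) =
        fun k : ℕ+ => (-tVar ^ (k : ℕ)) • adams k g := by
    funext k
    rw [Pi.smul_apply', subst_smul ha, subst_X ha]
  have hcomm : symComm = (PowerSeries.exp Coef).subst powerSumLog - 1 := rfl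
  rw [plethysm, suspension, subst_mul ha, hC, hcomm, map_sub, map_one, subst_sub ha, hone,
    rescale_eq_subst, subst_comp_subst_apply hrescale ha, hcomp, PowerSeries.subst_def,
    PowerSeries.subst_def, subst_comp_subst_apply hasSubst_powerSumLog.const
      (hasSubst_smul_adams _ hg)]

theorem plethysm_suspension_symComm_treeSeries :
    plethysm (suspension symComm) (treeSeries Coef 1) =
      C (-(1 / tVar)) * (forestSeries (fun k : ℕ+ => -tVar ^ (k : ℕ)) - 1) := by
  have hg : constantCoeff (treeSeries Coef 1) = 0 := by simp [treeSeries]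
  have hlog : subst (fun k : ℕ+ => (-tVar ^ (k : ℕ)) • adams k (treeSeries Coef 1)) powerSumLog =
      coeffSeries (forestPoly fun k : ℕ+ => -tVar ^ (k : ℕ)) 1 := by
    ext d
    rw [coeff_subst_powerSumLog (hasSubst_smul_adams _ hg), coeff_coeffSeries_one_forestPoly]
    refine finsum_congr fun k => ?_
    rw [coeff_smul, adams_treeSeries_one]
    ring
  have hexp : (PowerSeries.exp Coef).subst
      (coeffSeries (forestPoly fun k : ℕ+ => -tVar ^ (k : ℕ)) 1) =
        forestSeries fun k : ℕ+ => -tVar ^ (k : ℕ) := by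
    ext d
    rw [(isBinomialType_forestPoly _).coeff_exp_subst_coeffSeries_one, eval_forestPoly, one_smul]
  rw [plethysm_suspension_symComm hg, hlog, hexp]

end Plethysm

section FunctionalForests

variable {C : Type*}

/-- The forests on `S` attached to `R`, encoded by their parent maps: the points outside `S` are
fixed, and iterating `φ` leads from every point of `S` to `R`. -/
def IsForestMap (S R : Finset C) (φ : C → C) : Prop :=
  (∀ c ∉ S, φ c = c) ∧ ∀ c ∈ S, ∃ m : ℕ, φ^[m] c ∈ R

theorem isForestMap_empty_iff {R : Finset C} {φ : C → C} : IsForestMap ∅ R φ ↔ φ = id := by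
  simp [IsForestMap, funext_iff]

namespace IsForestMap

variable {S R I : Finset C} {φ : C → C}

theorem apply_mem (hφ : IsForestMap S R φ) (hSR : Disjoint S R) {c : C} (hc : c ∈ S) :
    φ c ∈ S ∨ φ c ∈ R := by
  obtain ⟨_ | m, hm⟩ := hφ.2 c hc
  · exact absurd hm (Finset.disjoint_left.1 hSR hc)
  · refine or_iff_not_imp_left.2 fun hS => ?_
    rwa [Function.iterate_succ_apply, Function.iterate_fixed (hφ.1 _ hS)] at hm

theorem induction (hφ : IsForestMap S R φ) (hSR : Disjoint S R) {p : C → Prop}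
    (base : ∀ c ∈ S, φ c ∈ R → p c) (step : ∀ c ∈ S, φ c ∈ S → p (φ c) → p c) :
    ∀ c ∈ S, p c := by
  have key : ∀ m : ℕ, ∀ c ∈ S, φ^[m] c ∈ R → p c := by
    intro m
    induction m with
    | zero => exact fun c hc hm => absurd hm (Finset.disjoint_left.1 hSR hc)
    | succ m ih =>
      intro c hc hm
      rcases hφ.apply_mem hSR hc with h | h
      · exact step c hc h (ih _ h hm)
      · exact base c hc h
  exact fun c hc => (hφ.2 c hc).elim fun m => key m c hc

variable [DecidableEq C]

theorem piecewise_id (hφ : IsForestMap S R φ) (hSR : Disjoint S R)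
    (hI : S.filter (fun c => φ c ∈ R) = I) :
    IsForestMap (S \ I) I (I.piecewise id φ) := by
  have hmem : ∀ c, c ∈ I ↔ c ∈ S ∧ φ c ∈ R := fun c => by rw [← hI, Finset.mem_filter]
  refine ⟨fun c hc => ?_, fun c hc => ?_⟩
  · by_cases hcI : c ∈ I
    · rw [Finset.piecewise_eq_of_mem _ _ _ hcI, id]
    · rw [Finset.piecewise_eq_of_notMem _ _ _ hcI, hφ.1 c]
      exact fun hcS => hc (Finset.mem_sdiff.2 ⟨hcS, hcI⟩)
  · refine hφ.induction hSR (p := fun c => ∃ m : ℕ, (I.piecewise id φ)^[m] c ∈ I)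
      (fun c hc hR => ⟨0, (hmem c).2 ⟨hc, hR⟩⟩) (fun c _ hS ⟨m, hm⟩ => ⟨m + 1, ?_⟩) c
      (Finset.mem_sdiff.1 hc).1
    have hcI : c ∉ I := fun h => Finset.disjoint_left.1 hSR hS ((hmem c).1 h).2
    rwa [Function.iterate_succ_apply, Finset.piecewise_eq_of_notMem _ _ _ hcI]

theorem sdiff_apply_mem {ψ : C → C} (hψ : IsForestMap (S \ I) I ψ) (hI : I ⊆ S) {c : C}
    (hc : c ∈ S \ I) : ψ c ∈ S :=
  (hψ.apply_mem Finset.sdiff_disjoint hc).elim (fun h => (Finset.mem_sdiff.1 h).1) fun h => hI h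

theorem piecewise {h ψ : C → C} (hψ : IsForestMap (S \ I) I ψ) (hI : I ⊆ S)
    (hh : ∀ c ∈ I, h c ∈ R) : IsForestMap S R (I.piecewise h ψ) := by
  have hmemI : ∀ c ∈ I, ∃ m : ℕ, (I.piecewise h ψ)^[m] c ∈ R := fun c hc =>
    ⟨1, by rw [Function.iterate_one, Finset.piecewise_eq_of_mem _ _ _ hc]; exact hh c hc⟩
  refine ⟨fun c hc => ?_, fun c hc => ?_⟩
  · rw [Finset.piecewise_eq_of_notMem _ _ _ fun h => hc (hI h)]
    exact hψ.1 c fun h => hc (Finset.mem_sdiff.1 h).1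
  by_cases hcI : c ∈ I
  · exact hmemI c hcI
  have hstep : ∀ c ∈ S \ I, (∃ m : ℕ, (I.piecewise h ψ)^[m] (ψ c) ∈ R) →
      ∃ m : ℕ, (I.piecewise h ψ)^[m] c ∈ R := fun c hc ⟨m, hm⟩ => ⟨m + 1, by
    rwa [Function.iterate_succ_apply,
      Finset.piecewise_eq_of_notMem _ _ _ (Finset.mem_sdiff.1 hc).2]⟩
  exact hψ.induction Finset.sdiff_disjoint (fun c hc hcI => hstep c hc (hmemI _ hcI))
    (fun c hc _ => hstep c hc) c (Finset.mem_sdiff.2 ⟨hc, hcI⟩)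

theorem filter_piecewise {h ψ : C → C} (hψ : IsForestMap (S \ I) I ψ) (hSR : Disjoint S R)
    (hI : I ⊆ S) (hh : ∀ c ∈ I, h c ∈ R) :
    S.filter (fun c => I.piecewise h ψ c ∈ R) = I := by
  ext c
  rw [Finset.mem_filter]
  by_cases hc : c ∈ I
  · simp only [Finset.piecewise_eq_of_mem _ _ _ hc, hh c hc, hI hc, hc, and_self]
  · simp only [Finset.piecewise_eq_of_notMem _ _ _ hc, hc, iff_false, not_and]
    exact fun hcS => Finset.disjoint_left.1 hSR
      (hψ.sdiff_apply_mem hI (Finset.mem_sdiff.2 ⟨hcS, hc⟩))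

end IsForestMap

variable [DecidableEq C]

theorem mem_piFinset_ite [Fintype C] {I R : Finset C} {h : C → C} :
    h ∈ Fintype.piFinset (fun c => if c ∈ I then R else {c}) ↔
      (∀ c ∈ I, h c ∈ R) ∧ ∀ c ∉ I, h c = c := by
  rw [Fintype.mem_piFinset, ← forall_and]
  refine forall_congr' fun c => ?_
  by_cases hc : c ∈ I <;> simp [hc]

theorem prod_sum_eq_sum_piFinset [Fintype C] {K : Type*} [CommSemiring K] (w : C → C → K)
    (I R : Finset C) :
    ∏ c ∈ I, ∑ c' ∈ R, w c c' =
      ∑ h ∈ Fintype.piFinset fun c => if c ∈ I then R else {c}, ∏ c ∈ I, w c (h c) := by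
  have h := Finset.prod_univ_sum (fun c => if c ∈ I then R else {c})
    fun c c' => if c ∈ I then w c c' else 1
  rw [← Finset.prod_subset (Finset.subset_univ I) fun c _ hc => by simp [hc]] at h
  simp only [Finset.prod_ite_mem, Finset.univ_inter] at h
  rw [← h]
  exact Finset.prod_congr rfl fun c hc => by simp only [hc, if_true]

variable [Fintype C] {K : Type*} [CommSemiring K]

open Classical in
/-- The sum over all forests on `S` attached to `R` of the products of the weights of the edges. -/
def forestSum (w : C → C → K) (S R : Finset C) : K :=
  ∑ φ : C → C with IsForestMap S R φ, ∏ c ∈ S, w c (φ c)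

theorem forestSum_empty (w : C → C → K) (R : Finset C) : forestSum w ∅ R = 1 := by
  simp [forestSum, isForestMap_empty_iff, Finset.filter_eq']

theorem forestSum_empty_right (w : C → C → K) {S : Finset C} (hS : S.Nonempty) :
    forestSum w S ∅ = 0 := by
  classical
  refine Finset.sum_eq_zero fun φ hφ => ?_
  obtain ⟨c, hc⟩ := hS
  obtain ⟨m, hm⟩ := (Finset.mem_filter.1 hφ).2.2 c hc
  exact absurd hm (Finset.notMem_empty _)

open Classical in
/-- Cutting the edges into `R` leaves a forest attached to the set `I` of their origins. -/
theorem sum_isForestMap_filter_eq (w : C → C → K) {S R I : Finset C} (hSR : Disjoint S R)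
    (hI : I ⊆ S) :
    ∑ φ : C → C with IsForestMap S R φ ∧ S.filter (fun c => φ c ∈ R) = I, ∏ c ∈ S, w c (φ c) =
      (∏ c ∈ I, ∑ c' ∈ R, w c c') * forestSum w (S \ I) I := by
  rw [prod_sum_eq_sum_piFinset, forestSum, Finset.sum_mul_sum, ← Finset.sum_product']
  refine Finset.sum_nbij' (fun φ => (I.piecewise φ id, I.piecewise id φ))
    (fun q => I.piecewise q.1 q.2) ?_ ?_ ?_ ?_ ?_
  · intro φ hφ
    obtain ⟨hφ, hfilter⟩ := (Finset.mem_filter.1 hφ).2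
    refine Finset.mem_product.2 ⟨mem_piFinset_ite.2 ⟨fun c hc => ?_, fun c hc => ?_⟩,
      Finset.mem_filter.2 ⟨Finset.mem_univ _, hφ.piecewise_id hSR hfilter⟩⟩
    · dsimp only
      rw [Finset.piecewise_eq_of_mem _ _ _ hc]
      rw [← hfilter] at hc
      exact (Finset.mem_filter.1 hc).2
    · exact Finset.piecewise_eq_of_notMem _ _ _ hc
  · rintro ⟨h, ψ⟩ hq
    obtain ⟨hh, hψ⟩ := Finset.mem_product.1 hq
    have hh := (mem_piFinset_ite.1 hh).1
    have hψ := (Finset.mem_filter.1 hψ).2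
    exact Finset.mem_filter.2
      ⟨Finset.mem_univ _, hψ.piecewise hI hh, hψ.filter_piecewise hSR hI hh⟩
  · intro φ _
    funext c
    by_cases hc : c ∈ I <;> simp [hc]
  · rintro ⟨h, ψ⟩ hq
    obtain ⟨hh, hψ⟩ := Finset.mem_product.1 hq
    have hh : ∀ c ∉ I, h c = c := (mem_piFinset_ite.1 hh).2
    have hψ : ∀ c ∉ S \ I, ψ c = c := (Finset.mem_filter.1 hψ).2.1
    refine Prod.ext (funext fun c => ?_) (funext fun c => ?_)
    · by_cases hc : c ∈ I
      · simp [hc]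
      · simp [hc, hh c hc]
    · by_cases hc : c ∈ I
      · simp [hc, hψ c]
      · simp [hc]
  · intro φ _
    rw [← Finset.prod_sdiff hI, mul_comm]
    congr 1
    · exact Finset.prod_congr rfl fun c hc => by simp [hc]
    · exact Finset.prod_congr rfl fun c hc => by simp [(Finset.mem_sdiff.1 hc).2]

theorem forestSum_eq_sum_powerset (w : C → C → K) {S R : Finset C} (hSR : Disjoint S R) :
    forestSum w S R =
      ∑ I ∈ S.powerset, (∏ c ∈ I, ∑ c' ∈ R, w c c') * forestSum w (S \ I) I := by
  rw [forestSum, ← Finset.sum_fiberwise_of_maps_to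
    (g := fun φ : C → C => S.filter fun c => φ c ∈ R) (t := S.powerset)
    fun φ _ => Finset.mem_powerset.2 (Finset.filter_subset _ _)]
  refine Finset.sum_congr rfl fun I hI => ?_
  rw [← sum_isForestMap_filter_eq w hSR (Finset.mem_powerset.1 hI), Finset.filter_filter]

end FunctionalForests

section Centralizers

variable {K : Type*} [Field K]

/-- The order of the centralizer of a permutation with `d k` cycles of each length `k`, which is
`z_μ` if `μ` is its cycle type. -/
def zExp (d : ℕ+ →₀ ℕ) : ℕ := d.prod fun k n => (k : ℕ) ^ n * n.factorial

theorem zExp_mul_coeff_forestSeries (u : ℕ+ → K) {d : ℕ+ →₀ ℕ} {T : Finset ℕ+}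
    (hT : d.support ⊆ T) :
    zExp d * coeff d (forestSeries u) = ∏ k ∈ T, ((k : ℕ) : K) ^ d k * ((d k).factorial : K) *
      (abelPoly ((k : ℕ) : K) (d k)).eval (u k + properLoad k d) := by
  rw [zExp, Finsupp.prod_of_support_subset d hT _ fun k _ => by simp,
    coeff_forestSeries_of_subset u d hT, Nat.cast_prod, ← Finset.prod_mul_distrib]
  push_cast
  rfl

/-- The summand for the forests whose roots form the part `i` of `i + j`. -/
theorem zExp_mul_coeff_forestSeries_fixedLoad (i j : ℕ+ →₀ ℕ) :
    zExp j * coeff j (forestSeries fun k => (fixedLoad k i : K)) =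
      ∏ k ∈ (i + j).support, ((k : ℕ) : K) ^ j k * ((j k).factorial : K) *
        (abelPoly ((k : ℕ) : K) (j k)).eval (((k : ℕ) : K) * i k + properLoad k (i + j)) := by
  have hsupp : j.support ⊆ (i + j).support := Finsupp.support_mono le_add_self
  rw [zExp_mul_coeff_forestSeries _ hsupp]
  refine Finset.prod_congr rfl fun k _ => ?_
  rw [fixedLoad_eq, map_add]
  push_cast
  rw [add_assoc]

theorem factorial_mul_eval_add_abelPoly [CharZero K] {k : K} (hk : k ≠ 0) (x e : K) (n : ℕ) :
    k ^ n * (n.factorial : K) * (abelPoly k n).eval (x + e) =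
      ∑ p ∈ antidiagonal n, (n.choose p.1 : K) * (x ^ p.1 *
        (k ^ (n - p.1) * ((n - p.1).factorial : K) *
          (abelPoly k (n - p.1)).eval (k * p.1 + e))) := by
  rw [eval_add_abelPoly_eq_sum_pow, Finset.mul_sum]
  refine Finset.sum_congr rfl fun p hp => ?_
  obtain rfl := mem_antidiagonal.1 hp
  have hfac : (p.1.factorial : K) ≠ 0 := Nat.cast_ne_zero.2 p.1.factorial_ne_zero
  have hchoose : ((p.1 + p.2).factorial : K) =
      (p.1 + p.2).choose p.1 * p.1.factorial * p.2.factorial := by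
    rw [Nat.choose_symm_add]
    exact_mod_cast (Nat.add_choose_mul_factorial_mul_factorial p.1 p.2).symm
  rw [Nat.add_sub_cancel_left, hchoose, pow_add]
  field_simp

theorem zExp_single_add (k : ℕ+) (e : ℕ+ →₀ ℕ) :
    zExp (Finsupp.single k 1 + e) = k * (e k + 1) * zExp e := by
  have hsub : (Finsupp.single k 1 + e).support ⊆ insert k e.support :=
    Finsupp.support_add.trans (Finset.union_subset
      (Finsupp.support_single_subset.trans (by simp)) (Finset.subset_insert _ _))
  rw [zExp, zExp, Finsupp.prod_of_support_subset _ hsub _ fun _ _ => by simp,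
    Finsupp.prod_of_support_subset e (Finset.subset_insert k _) _ fun _ _ => by simp,
    ← Finset.mul_prod_erase _ _ (Finset.mem_insert_self _ _),
    ← Finset.mul_prod_erase _ _ (Finset.mem_insert_self _ _),
    Finset.prod_congr rfl fun j hj => by
      rw [Finsupp.add_apply, Finsupp.single_eq_of_ne (Finset.ne_of_mem_erase hj), zero_add],
    Finsupp.add_apply, Finsupp.single_eq_same, add_comm 1, Nat.factorial_succ, pow_succ]
  ring

theorem zExp_mul_coeff_treeSeries_one (d : ℕ+ →₀ ℕ) :
    zExp d * coeff d (treeSeries K 1) = d 1 * (zExp (d - Finsupp.single 1 1) *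
      coeff (d - Finsupp.single 1 1)
        (forestSeries fun k => (fixedLoad k (Finsupp.single 1 1) : K))) := by
  rcases Nat.eq_zero_or_pos (d 1) with h | h
  · rw [h, treeSeries, X_def, coeff_monomial_mul, if_neg (by simp [h])]
    simp
  · obtain ⟨e, rfl⟩ : ∃ e, d = Finsupp.single 1 1 + e :=
      ⟨_, (add_tsub_cancel_of_le (Finsupp.single_le_iff.2 h)).symm⟩
    rw [coeff_single_add_treeSeries, add_tsub_cancel_left, zExp_single_add]
    simp [add_comm, mul_assoc]

end Centralizers

section CycleWeights

variable {C : Type*} (l : C → ℕ+)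

/-- The number of elements of `S` of each length, as an exponent: the cycle type of a set `S` of
cycles of lengths `l`. -/
def lengthCount (S : Finset C) : ℕ+ →₀ ℕ := ∑ c ∈ S, Finsupp.single (l c) 1

theorem lengthCount_apply (S : Finset C) (k : ℕ+) :
    lengthCount l S k = (S.filter fun c => l c = k).card := by
  rw [lengthCount, Finsupp.finsetSum_apply, Finset.card_filter]
  exact Finset.sum_congr rfl fun c _ => Finsupp.single_apply

theorem lengthCount_add_sdiff [DecidableEq C] {S I : Finset C} (hI : I ⊆ S) :
    lengthCount l I + lengthCount l (S \ I) = lengthCount l S := by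
  rw [lengthCount, lengthCount, lengthCount, add_comm, Finset.sum_sdiff hI]

theorem mem_support_lengthCount {S : Finset C} {c : C} (hc : c ∈ S) :
    l c ∈ (lengthCount l S).support := by
  rw [Finsupp.mem_support_iff, lengthCount_apply, Finset.card_ne_zero]
  exact ⟨c, Finset.mem_filter.2 ⟨hc, rfl⟩⟩

theorem sum_powerset_prod_card_filter {K : Type*} [CommSemiring K] (S : Finset C) (T : Finset ℕ+)
    (hT : ∀ c ∈ S, l c ∈ T) (g : ℕ+ → ℕ → K) :
    ∑ I ∈ S.powerset, ∏ k ∈ T, g k (I.filter fun c => l c = k).card =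
      ∏ k ∈ T, ∑ J ∈ (S.filter fun c => l c = k).powerset, g k J.card := by
  classical
  rw [Finset.prod_sum]
  refine Finset.sum_bij' (fun I _ k _ => I.filter fun c => l c = k)
    (fun p _ => T.attach.biUnion fun k => p k.1 k.2) ?_ ?_ ?_ ?_ ?_
  · exact fun I hI => Finset.mem_pi.2 fun k _ => Finset.mem_powerset.2
      (Finset.filter_subset_filter _ (Finset.mem_powerset.1 hI))
  · exact fun p hp => Finset.mem_powerset.2 <| Finset.biUnion_subset.2 fun k _ =>
      (Finset.mem_powerset.1 (Finset.mem_pi.1 hp k.1 k.2)).trans (Finset.filter_subset _ _)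
  · intro I hI
    ext c
    simpa using fun hc => hT c (Finset.mem_powerset.1 hI hc)
  · intro p hp
    have hlen : ∀ k (hk : k ∈ T), ∀ c ∈ p k hk, l c = k := fun k hk c hc =>
      (Finset.mem_filter.1 (Finset.mem_powerset.1 (Finset.mem_pi.1 hp k hk) hc)).2
    funext k hk
    ext c
    simp only [Finset.mem_filter, Finset.mem_biUnion, Finset.mem_attach, true_and, Subtype.exists]
    refine ⟨?_, fun hc => ⟨⟨k, hk, hc⟩, hlen k hk c hc⟩⟩
    rintro ⟨⟨j, hj, hc⟩, rfl⟩
    obtain rfl := hlen j hj c hc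
    exact hc
  · exact fun I _ => (Finset.prod_attach T fun k => g k (I.filter fun c => l c = k).card).symm

theorem sum_powerset_prod_lengthCount {K : Type*} [CommSemiring K] (S : Finset C) (T : Finset ℕ+)
    (hT : ∀ c ∈ S, l c ∈ T) (g : ℕ+ → ℕ → K) :
    ∑ I ∈ S.powerset, ∏ k ∈ T, g k (lengthCount l I k) =
      ∏ k ∈ T, ∑ p ∈ antidiagonal (lengthCount l S k),
        ((lengthCount l S k).choose p.1 : K) * g k p.1 := by
  simp only [lengthCount_apply, sum_powerset_prod_card_filter l S T hT,
    Finset.sum_powerset_apply_card (g _), Finset.Nat.sum_antidiagonal_eq_sum_range_succ_mk,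
    nsmul_eq_mul]

theorem prod_comp_eq_prod_pow_lengthCount {K : Type*} [CommMonoid K] {S : Finset C} {T : Finset ℕ+}
    (hT : ∀ c ∈ S, l c ∈ T) (u : ℕ+ → K) :
    ∏ c ∈ S, u (l c) = ∏ k ∈ T, u k ^ lengthCount l S k := by
  rw [← Finset.prod_fiberwise_of_maps_to hT]
  refine Finset.prod_congr rfl fun k _ => ?_
  rw [lengthCount_apply, ← Finset.prod_const]
  exact Finset.prod_congr rfl fun c hc => by rw [(Finset.mem_filter.1 hc).2]

theorem zExp_mul_coeff_forestSeries_eq_sum_powerset [DecidableEq C] {K : Type*} [Field K]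
    [CharZero K] (u : ℕ+ → K) (S : Finset C) :
    zExp (lengthCount l S) * coeff (lengthCount l S) (forestSeries u) =
      ∑ I ∈ S.powerset, (∏ c ∈ I, u (l c)) * (zExp (lengthCount l (S \ I)) *
        coeff (lengthCount l (S \ I))
          (forestSeries fun k => (fixedLoad k (lengthCount l I) : K))) := by
  have hT : ∀ c ∈ S, l c ∈ (lengthCount l S).support := fun c => mem_support_lengthCount l
  rw [zExp_mul_coeff_forestSeries u subset_rfl, Finset.prod_congr rfl fun k _ =>
    factorial_mul_eval_add_abelPoly (Nat.cast_ne_zero.2 k.ne_zero) _ _ _,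
    ← sum_powerset_prod_lengthCount l S _ hT fun k n => u k ^ n *
      (((k : ℕ) : K) ^ (lengthCount l S k - n) * ((lengthCount l S k - n).factorial : K) *
        (abelPoly ((k : ℕ) : K) (lengthCount l S k - n)).eval
          (((k : ℕ) : K) * n + properLoad k (lengthCount l S)))]
  refine Finset.sum_congr rfl fun I hI => ?_
  rw [Finset.mem_powerset] at hI
  have hsub : ∀ k, lengthCount l S k - lengthCount l I k = lengthCount l (S \ I) k := fun k => by
    rw [← lengthCount_add_sdiff l hI, Finsupp.add_apply, Nat.add_sub_cancel_left]
  rw [prod_comp_eq_prod_pow_lengthCount l (fun c hc => hT c (hI hc)),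
    zExp_mul_coeff_forestSeries_fixedLoad, lengthCount_add_sdiff l hI, ← Finset.prod_mul_distrib]
  simp only [hsub]

/-- The number of points of a cycle of length `l c'` to which a point on a cycle of length `l c`
can be mapped by an equivariant map. -/
def cycleWeight (c c' : C) : ℕ := if (l c' : ℕ) ∣ l c then l c' else 0

theorem sum_cycleWeight (c : C) (R : Finset C) :
    ∑ c' ∈ R, cycleWeight l c c' = fixedLoad (l c) (lengthCount l R) := by
  simp [cycleWeight, lengthCount, fixedLoad_single]

theorem forestSum_cycleWeight [Fintype C] [DecidableEq C] {K : Type*} [Field K] [CharZero K]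
    {S R : Finset C} (hSR : Disjoint S R) :
    ((forestSum (cycleWeight l) S R : ℕ) : K) = zExp (lengthCount l S) *
      coeff (lengthCount l S)
        (forestSeries fun k => (fixedLoad k (lengthCount l R) : K)) := by
  induction S using Finset.strongInduction generalizing R with
  | H S ih =>
  rcases S.eq_empty_or_nonempty with rfl | hS
  · simp [forestSum_empty, lengthCount, zExp, coeff_forestSeries]
  rw [forestSum_eq_sum_powerset _ hSR, zExp_mul_coeff_forestSeries_eq_sum_powerset]
  push_cast
  refine Finset.sum_congr rfl fun I hI => ?_
  rw [Finset.mem_powerset] at hI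
  simp only [← Nat.cast_sum, sum_cycleWeight]
  congr 1
  rcases I.eq_empty_or_nonempty with rfl | hI'
  · obtain ⟨c, hc⟩ := hS
    have hd : lengthCount l S ≠ 0 :=
      Finsupp.support_nonempty_iff.1 ⟨_, mem_support_lengthCount l hc⟩
    have hzero : (fun k => (fixedLoad k (lengthCount l ∅) : K)) = 0 := by
      funext k
      simp [lengthCount]
    rw [Finset.sdiff_empty, forestSum_empty_right _ ⟨c, hc⟩, hzero, forestSeries_zero, coeff_one,
      if_neg hd, Nat.cast_zero, mul_zero]
  · exact ih _ (Finset.sdiff_ssubset hI hI') Finset.sdiff_disjoint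

end CycleWeights

section Cycles

variable {V : Type*} (σ : Equiv.Perm V)

/-- The cycles of `σ`, including the fixed points. -/
def CycleClass : Type _ := Quotient (Equiv.Perm.SameCycle.setoid σ)

/-- The cycle of a point. -/
def cycleClass (v : V) : CycleClass σ := Quotient.mk (Equiv.Perm.SameCycle.setoid σ) v

/-- A point on a cycle. -/
def cycleRep (c : CycleClass σ) : V := Quotient.out c

theorem cycleClass_eq_iff {v w : V} : cycleClass σ v = cycleClass σ w ↔ σ.SameCycle v w :=
  Quotient.eq (r := Equiv.Perm.SameCycle.setoid σ)

theorem cycleClass_rep (c : CycleClass σ) : cycleClass σ (cycleRep σ c) = c := Quotient.out_eq c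

theorem cycleClass_zpow_apply (i : ℤ) (v : V) : cycleClass σ ((σ ^ i) v) = cycleClass σ v :=
  (cycleClass_eq_iff σ).2 (Equiv.Perm.SameCycle.symm ⟨i, rfl⟩)

theorem exists_zpow_cycleRep (v : V) : ∃ i : ℤ, (σ ^ i) (cycleRep σ (cycleClass σ v)) = v :=
  (cycleClass_eq_iff σ).1 (cycleClass_rep σ (cycleClass σ v))

theorem eq_of_cycleClass_eq_of_apply_eq {r v : V} (hr : σ r = r)
    (h : cycleClass σ v = cycleClass σ r) : v = r := by
  obtain ⟨i, hi⟩ := (cycleClass_eq_iff σ).1 h.symm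
  rw [← hi, Equiv.Perm.zpow_apply_eq_self_of_apply_eq_self hr]

variable [Fintype V]

instance : Fintype (CycleClass σ) :=
  have : Finite (CycleClass σ) := Quotient.finite _
  Fintype.ofFinite _

/-- The length of a cycle. -/
def cycleLength (c : CycleClass σ) : ℕ+ :=
  ⟨Function.minimalPeriod (σ • ·) (cycleRep σ c), Nat.pos_of_ne_zero
    (MulAction.minimalPeriod_pos σ (cycleRep σ c)).out⟩

theorem zpow_apply_eq_self_iff (i : ℤ) (v : V) :
    (σ ^ i) v = v ↔ ((cycleLength σ (cycleClass σ v) : ℕ) : ℤ) ∣ i := by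
  obtain ⟨j, hj⟩ := exists_zpow_cycleRep σ v
  rw [cycleLength, PNat.mk_coe, ← MulAction.zpow_smul_eq_iff_minimalPeriod_dvd, Equiv.Perm.smul_def]
  conv_lhs => rw [← hj, ← Equiv.Perm.mul_apply, ← zpow_add, add_comm, zpow_add,
    Equiv.Perm.mul_apply]
  exact (σ ^ j).injective.eq_iff

theorem pow_apply_eq_self_iff (k : ℕ) (v : V) :
    (σ ^ k) v = v ↔ (cycleLength σ (cycleClass σ v) : ℕ) ∣ k := by
  rw [← zpow_natCast, zpow_apply_eq_self_iff, Int.natCast_dvd_natCast]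

theorem cycleLength_eq_one_iff (v : V) : cycleLength σ (cycleClass σ v) = 1 ↔ σ v = v := by
  rw [← PNat.coe_eq_one_iff, ← Nat.dvd_one, ← pow_apply_eq_self_iff, pow_one]

theorem zpow_apply_eq_zpow_apply_iff (i j : ℤ) (v : V) :
    (σ ^ i) v = (σ ^ j) v ↔ ((cycleLength σ (cycleClass σ v) : ℕ) : ℤ) ∣ i - j := by
  rw [← zpow_apply_eq_self_iff, sub_eq_neg_add, zpow_add, zpow_neg, Equiv.Perm.mul_apply,
    Equiv.Perm.inv_eq_iff_eq]

open Classical in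
theorem card_filter_cycleClass_eq (c : CycleClass σ) :
    (Finset.univ.filter fun v => cycleClass σ v = c).card = cycleLength σ c := by
  rw [cycleLength, PNat.mk_coe, MulAction.minimalPeriod_eq_card, ← Fintype.card_coe]
  refine Fintype.card_congr (Equiv.subtypeEquivRight fun v => ?_)
  rw [Finset.mem_filter, MulAction.mem_orbit_iff]
  constructor
  · rintro ⟨-, rfl⟩
    obtain ⟨i, hi⟩ := exists_zpow_cycleRep σ v
    exact ⟨⟨σ ^ i, i, rfl⟩, hi⟩
  · rintro ⟨⟨_, i, rfl⟩, h⟩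
    refine ⟨Finset.mem_univ _, ?_⟩
    rw [← h]
    exact (cycleClass_zpow_apply σ i _).trans (cycleClass_rep σ c)

open Classical in
theorem card_filter_pow_apply_eq_self (k : ℕ) (c : CycleClass σ) :
    (Finset.univ.filter fun v => (σ ^ k) v = v ∧ cycleClass σ v = c).card =
      if (cycleLength σ c : ℕ) ∣ k then (cycleLength σ c : ℕ) else 0 := by
  split_ifs with h
  · rw [← card_filter_cycleClass_eq]
    congr 1
    refine Finset.filter_congr fun v _ => and_iff_right_of_imp ?_
    rintro rfl
    exact (pow_apply_eq_self_iff σ k v).2 h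
  · rw [Finset.card_eq_zero, Finset.filter_eq_empty_iff]
    rintro v - ⟨hv, rfl⟩
    exact h ((pow_apply_eq_self_iff σ k v).1 hv)

theorem card_fixed_pow (k : ℕ+) :
    Nat.card {v : V // (σ ^ (k : ℕ)) v = v} =
      fixedLoad k (lengthCount (cycleLength σ) Finset.univ) := by
  classical
  rw [Nat.card_eq_fintype_card, Fintype.card_subtype,
    Finset.card_eq_sum_card_fiberwise (f := cycleClass σ) (t := Finset.univ)
      (fun _ _ => Finset.mem_coe.2 (Finset.mem_univ _)), lengthCount, map_sum]
  refine Finset.sum_congr rfl fun c _ => ?_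
  rw [Finset.filter_filter, card_filter_pow_apply_eq_self, fixedLoad_single, one_mul]

theorem lengthCount_one :
    lengthCount (cycleLength σ) Finset.univ 1 = Nat.card {v : V // σ v = v} := by
  have h := card_fixed_pow σ 1
  rw [PNat.one_coe, pow_one, fixedLoad_eq, properLoad_eq_zero fun _ _ _ => one_le] at h
  simpa using h.symm

theorem card_support_cycleOf [DecidableEq V] {v : V} (hv : v ∈ σ.support) :
    (σ.cycleOf v).support.card = cycleLength σ (cycleClass σ v) := by
  classical
  rw [← card_filter_cycleClass_eq]
  congr 1
  ext w
  rw [Equiv.Perm.mem_support_cycleOf_iff' (Equiv.Perm.mem_support.1 hv), Finset.mem_filter,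
    cycleClass_eq_iff, Equiv.Perm.sameCycle_comm, and_iff_right (Finset.mem_univ w)]

theorem cycleRep_mem_support [DecidableEq V] {c : CycleClass σ} :
    cycleRep σ c ∈ σ.support ↔ cycleLength σ c ≠ 1 := by
  rw [Equiv.Perm.mem_support, Ne, ← cycleLength_eq_one_iff, cycleClass_rep]

theorem lengthCount_eq_count_cycleType [DecidableEq V] {k : ℕ+} (hk : k ≠ 1) :
    lengthCount (cycleLength σ) Finset.univ k = σ.cycleType.count (k : ℕ) := by
  classical
  rw [Equiv.Perm.cycleType, Multiset.count_map, lengthCount_apply]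
  have hsupp {c} (hc : c ∈ Finset.univ.filter fun c => cycleLength σ c = k) :
      cycleRep σ c ∈ σ.support := by
    rwa [cycleRep_mem_support, (Finset.mem_filter.1 hc).2]
  refine Finset.card_nbij (t := σ.cycleFactorsFinset.filter fun τ =>
    (k : ℕ) = (Finset.card ∘ Equiv.Perm.support) τ) (fun c => σ.cycleOf (cycleRep σ c)) ?_ ?_ ?_
  · intro c hc
    refine Finset.mem_filter.2
      ⟨Equiv.Perm.cycleOf_mem_cycleFactorsFinset_iff.2 (hsupp hc), ?_⟩
    rw [Function.comp_apply, card_support_cycleOf σ (hsupp hc), cycleClass_rep,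
      (Finset.mem_filter.1 hc).2]
  · intro c hc c' hc' h
    rw [← cycleClass_rep σ c, ← cycleClass_rep σ c', cycleClass_eq_iff]
    exact (Equiv.Perm.sameCycle_iff_cycleOf_eq_of_mem_support (hsupp hc) (hsupp hc')).2 h
  · intro τ hτ
    obtain ⟨hτ, hcard⟩ := Finset.mem_filter.1 hτ
    obtain ⟨a, ha⟩ := (Equiv.Perm.mem_cycleFactorsFinset_iff.1 hτ).1.nonempty_support
    have hτa := Equiv.Perm.cycle_is_cycleOf ha hτ
    have hrep : σ.cycleOf (cycleRep σ (cycleClass σ a)) = σ.cycleOf a :=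
      Equiv.Perm.SameCycle.cycleOf_eq ((cycleClass_eq_iff σ).1 (cycleClass_rep σ (cycleClass σ a)))
    refine ⟨cycleClass σ a, Finset.mem_filter.2 ⟨Finset.mem_univ _, PNat.coe_injective ?_⟩,
      hrep.trans hτa.symm⟩
    rw [← card_support_cycleOf σ (Equiv.Perm.mem_cycleFactorsFinset_support_le hτ ha), ← hτa]
    exact hcard.symm

theorem lengthCount_eq_count_parts [DecidableEq V] (k : ℕ+) :
    lengthCount (cycleLength σ) Finset.univ k = σ.partition.parts.count (k : ℕ) := by
  rw [Equiv.Perm.parts_partition, Multiset.count_add, Multiset.count_replicate]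
  rcases eq_or_ne k 1 with rfl | hk
  · have h1 : σ.cycleType.count 1 = 0 := Multiset.count_eq_zero_of_notMem fun h =>
      absurd (Equiv.Perm.two_le_of_mem_cycleType h) (by simp)
    rw [lengthCount_one, PNat.one_coe, h1, if_pos rfl, zero_add, ← Finset.card_compl,
      Nat.card_eq_fintype_card, Fintype.card_subtype]
    congr 1
    ext v
    simp
  · rw [if_neg fun h => hk (PNat.coe_eq_one_iff.1 h.symm), add_zero,
      lengthCount_eq_count_cycleType σ hk]

end Cycles

section EquivariantMaps

variable {V : Type*} {σ : Equiv.Perm V}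

theorem apply_zpow_apply_of_commute {f : V → V} (hf : Function.Commute f σ) (i : ℤ) (v : V) :
    f ((σ ^ i) v) = (σ ^ i) (f v) := by
  have hpow : ∀ {τ : Equiv.Perm V}, Function.Commute f τ → ∀ n : ℕ, f ((τ ^ n) v) = (τ ^ n) (f v) :=
    fun hτ n => by simpa only [Equiv.Perm.iterate_eq_pow] using hτ.iterate_right n v
  rcases Int.eq_nat_or_neg i with ⟨n, rfl | rfl⟩
  · simpa only [zpow_natCast] using hpow hf n
  · have hinv : Function.Commute f ⇑σ⁻¹ := hf.inverses_right σ.right_inv σ.left_inv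
    simpa only [zpow_neg, zpow_natCast, inv_pow] using hpow hinv n

variable (σ) in
/-- The map induced on the cycles of `σ` by a map `f` commuting with `σ`. -/
def cycleMap (f : V → V) (c : CycleClass σ) : CycleClass σ := cycleClass σ (f (cycleRep σ c))

theorem semiconj_cycleClass_cycleMap {f : V → V} (hf : Function.Commute f σ) :
    Function.Semiconj (cycleClass σ) f (cycleMap σ f) := fun v => by
  obtain ⟨i, hi⟩ := exists_zpow_cycleRep σ v
  conv_lhs => rw [← hi, apply_zpow_apply_of_commute hf, cycleClass_zpow_apply]
  rfl

/-- The map commuting with `σ` that has the value `y c` at the representative of each cycle `c`. -/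
def commuteExtend (y : CycleClass σ → V) (v : V) : V :=
  (σ ^ (exists_zpow_cycleRep σ v).choose) (y (cycleClass σ v))

theorem rooted_iff_isForestMap_cycleMap [Fintype V] [DecidableEq (CycleClass σ)] {f : V → V}
    (hf : Function.Commute f σ) {r : V} (hr : σ r = r) :
    (f r = r ∧ ∀ v, ∃ m : ℕ, f^[m] v = r) ↔
      IsForestMap (Finset.univ.erase (cycleClass σ r)) {cycleClass σ r} (cycleMap σ f) := by
  have hf := semiconj_cycleClass_cycleMap hf
  have hiter : ∀ (m : ℕ) v, (cycleMap σ f)^[m] (cycleClass σ v) = cycleClass σ r ↔ f^[m] v = r :=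
    fun m v => by
      rw [← hf.iterate_right m v]
      exact ⟨eq_of_cycleClass_eq_of_apply_eq σ hr, congrArg _⟩
  have hroot := hiter 1 r
  rw [Function.iterate_one, Function.iterate_one] at hroot
  simp only [IsForestMap, Finset.mem_erase, Finset.mem_univ, and_true, not_not, forall_eq,
    Finset.mem_singleton, hroot, and_congr_right_iff]
  refine fun _ => ⟨fun h c _ => ?_, fun h v => ?_⟩
  · obtain ⟨m, hm⟩ := h (cycleRep σ c)
    exact ⟨m, by rwa [← hiter, cycleClass_rep] at hm⟩
  · by_cases hv : cycleClass σ v = cycleClass σ r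
    · exact ⟨0, eq_of_cycleClass_eq_of_apply_eq σ hr hv⟩
    · exact (h _ hv).imp fun m => (hiter m v).1

variable [Fintype V]

theorem cycleLength_dvd_of_commute {f : V → V} (hf : Function.Commute f σ) (v : V) :
    (cycleLength σ (cycleClass σ (f v)) : ℕ) ∣ cycleLength σ (cycleClass σ v) := by
  rw [← pow_apply_eq_self_iff, ← zpow_natCast, ← apply_zpow_apply_of_commute hf,
    (zpow_apply_eq_self_iff σ _ v).2 dvd_rfl]

section Extend

variable {y : CycleClass σ → V}
  (hy : ∀ c, (cycleLength σ (cycleClass σ (y c)) : ℕ) ∣ cycleLength σ c)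

include hy

theorem commuteExtend_zpow_apply_cycleRep (i : ℤ) (c : CycleClass σ) :
    commuteExtend y ((σ ^ i) (cycleRep σ c)) = (σ ^ i) (y c) := by
  have hj := (exists_zpow_cycleRep σ ((σ ^ i) (cycleRep σ c))).choose_spec
  rw [commuteExtend]
  generalize (exists_zpow_cycleRep σ ((σ ^ i) (cycleRep σ c))).choose = j at hj ⊢
  rw [cycleClass_zpow_apply, cycleClass_rep] at hj ⊢
  rw [zpow_apply_eq_zpow_apply_iff, cycleClass_rep] at hj
  exact (zpow_apply_eq_zpow_apply_iff σ _ _ _).2 ((Int.natCast_dvd_natCast.2 (hy c)).trans hj)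

theorem commuteExtend_cycleRep (c : CycleClass σ) : commuteExtend y (cycleRep σ c) = y c :=
  commuteExtend_zpow_apply_cycleRep hy 0 c

theorem commute_commuteExtend : Function.Commute (commuteExtend y) σ := fun v => by
  obtain ⟨i, hi⟩ := exists_zpow_cycleRep σ v
  rw [← hi, commuteExtend_zpow_apply_cycleRep hy, ← Equiv.Perm.mul_apply, ← zpow_one_add,
    commuteExtend_zpow_apply_cycleRep hy, zpow_one_add, Equiv.Perm.mul_apply]

end Extend

/-- A map that commutes with `σ` is given by its values at the representatives of the cycles, which
can be any points on cycles of lengths dividing those of the given cycles. -/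
def commuteEquiv (φ : CycleClass σ → CycleClass σ) :
    {f : V → V // Function.Commute f σ ∧ cycleMap σ f = φ} ≃
      ((c : CycleClass σ) → {v : V // (cycleLength σ (φ c) : ℕ) ∣ cycleLength σ c ∧
        cycleClass σ v = φ c}) where
  toFun f c := ⟨f.1 (cycleRep σ c), by
    have h := cycleLength_dvd_of_commute f.2.1 (cycleRep σ c)
    have hφ : cycleClass σ (f.1 (cycleRep σ c)) = φ c := congrFun f.2.2 c
    rw [cycleClass_rep, hφ] at h
    exact ⟨h, hφ⟩⟩
  invFun y := ⟨commuteExtend fun c => (y c).1,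
    commute_commuteExtend fun c => (y c).2.2.symm ▸ (y c).2.1, funext fun c => by
      rw [cycleMap, commuteExtend_cycleRep fun c => (y c).2.2.symm ▸ (y c).2.1, (y c).2.2]⟩
  left_inv f := Subtype.ext <| funext fun v => by
    change (σ ^ _) (f.1 (cycleRep σ (cycleClass σ v))) = f.1 v
    rw [← apply_zpow_apply_of_commute f.2.1, (exists_zpow_cycleRep σ v).choose_spec]
  right_inv y := funext fun c => Subtype.ext <|
    commuteExtend_cycleRep (fun c => (y c).2.2.symm ▸ (y c).2.1) c

theorem card_commute_cycleMap_eq (φ : CycleClass σ → CycleClass σ) :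
    Nat.card {f : V → V // Function.Commute f σ ∧ cycleMap σ f = φ} =
      ∏ c, cycleWeight (cycleLength σ) c (φ c) := by
  classical
  rw [Nat.card_congr (commuteEquiv φ), Nat.card_pi]
  refine Finset.prod_congr rfl fun c _ => ?_
  rw [cycleWeight]
  split_ifs with h
  · simp [h, Fintype.card_subtype, card_filter_cycleClass_eq]
  · simp [h]

open Classical in
theorem card_commute_rooted {r : V} (hr : σ r = r) :
    Nat.card {f : V → V // Function.Commute f σ ∧ f r = r ∧ ∀ v, ∃ m : ℕ, f^[m] v = r} =
      forestSum (cycleWeight (cycleLength σ)) (Finset.univ.erase (cycleClass σ r))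
        {cycleClass σ r} := by
  have hfilter : ∀ f : V → V, (Function.Commute f σ ∧ f r = r ∧ ∀ v, ∃ m : ℕ, f^[m] v = r) ↔
      IsForestMap (Finset.univ.erase (cycleClass σ r)) {cycleClass σ r} (cycleMap σ f) ∧
        Function.Commute f σ := fun f => by
    rw [and_comm]
    exact and_congr_left fun hf => rooted_iff_isForestMap_cycleMap hf hr
  rw [Nat.card_eq_fintype_card, Fintype.card_subtype, forestSum,
    Finset.card_eq_sum_card_fiberwise (f := cycleMap σ) (t := Finset.univ.filter fun φ =>
      IsForestMap (Finset.univ.erase (cycleClass σ r)) {cycleClass σ r} φ) fun f hf =>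
      Finset.mem_coe.2 (Finset.mem_filter.2 ⟨Finset.mem_univ _,
        ((hfilter f).1 (Finset.mem_filter.1 hf).2).1⟩)]
  refine Finset.sum_congr rfl fun φ hφ => ?_
  have hφ := (Finset.mem_filter.1 hφ).2
  have hroot : cycleWeight (cycleLength σ) (cycleClass σ r) (φ (cycleClass σ r)) = 1 := by
    rw [hφ.1 _ (Finset.notMem_erase _ _), cycleWeight, (cycleLength_eq_one_iff σ r).2 hr,
      if_pos dvd_rfl, PNat.one_coe]
  rw [← one_mul (∏ c ∈ _, _), ← hroot, Finset.mul_prod_erase Finset.univ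
    (fun c => cycleWeight (cycleLength σ) c (φ c)) (Finset.mem_univ _), ← card_commute_cycleMap_eq,
    Finset.filter_filter, Nat.card_eq_fintype_card, Fintype.card_subtype]
  congr 1
  refine Finset.filter_congr fun f _ => ?_
  rw [hfilter]
  exact ⟨fun h => ⟨h.1.2, h.2⟩, fun h => ⟨⟨h.2 ▸ hφ, h.1⟩, h.2⟩⟩

end EquivariantMaps

section FixedTrees

variable {V : Type} (σ : Equiv.Perm V)

instance [Finite V] : Finite (LabelledRootedTree V) :=
  Finite.of_injective (fun T => (T.root, T.parent)) fun _ _ h =>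
    LabelledRootedTree.ext (congrArg Prod.fst h) (congrArg Prod.snd h)

theorem smul_tree_eq_iff (T : LabelledRootedTree V) :
    σ • T = T ↔ σ T.root = T.root ∧ Function.Commute T.parent σ := by
  rw [LabelledRootedTree.ext_iff]
  refine and_congr Iff.rfl ⟨fun h v => ?_, fun h => funext fun v => ?_⟩
  · have h1 : σ (T.parent (σ.symm (σ v))) = T.parent (σ v) := congrFun h (σ v)
    rw [← h1, σ.symm_apply_apply]
  · change σ (T.parent (σ.symm v)) = T.parent v
    rw [← h, σ.apply_symm_apply]

/-- A rooted tree fixed by `σ` is a fixed root together with a parent map commuting with `σ`. -/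
def fixedTreeEquiv : {T : LabelledRootedTree V // σ • T = T} ≃
    Σ r : {r : V // σ r = r}, {f : V → V // Function.Commute f σ ∧ f r = r ∧
      ∀ v, ∃ m : ℕ, f^[m] v = r} where
  toFun T := ⟨⟨T.1.root, ((smul_tree_eq_iff σ T.1).1 T.2).1⟩, T.1.parent,
    ((smul_tree_eq_iff σ T.1).1 T.2).2, T.1.parent_root, T.1.reaches_root⟩
  invFun p := ⟨⟨p.1.1, p.2.1, p.2.2.2.1, p.2.2.2.2⟩, (smul_tree_eq_iff σ _).2 ⟨p.1.2, p.2.2.1⟩⟩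
  left_inv _ := rfl
  right_inv _ := rfl

theorem card_fixedTree [Fintype V] (K : Type*) [Field K] [CharZero K] :
    (Nat.card {T : LabelledRootedTree V // σ • T = T} : K) =
      zExp (lengthCount (cycleLength σ) Finset.univ) *
        coeff (lengthCount (cycleLength σ) Finset.univ) (treeSeries K 1) := by
  classical
  rw [Nat.card_congr (fixedTreeEquiv σ), Nat.card_sigma, Nat.cast_sum,
    zExp_mul_coeff_treeSeries_one, lengthCount_one, Nat.card_eq_fintype_card, ← nsmul_eq_mul,
    ← Finset.card_univ, ← Finset.sum_const]
  refine Finset.sum_congr rfl fun r _ => ?_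
  have hr : lengthCount (cycleLength σ) {cycleClass σ r} = Finsupp.single 1 1 := by
    rw [lengthCount, Finset.sum_singleton, (cycleLength_eq_one_iff σ r).2 r.2]
  have herase : lengthCount (cycleLength σ) (Finset.univ.erase (cycleClass σ r)) =
      lengthCount (cycleLength σ) Finset.univ - Finsupp.single 1 1 := by
    rw [← lengthCount_add_sdiff (cycleLength σ) (Finset.subset_univ {cycleClass σ r}), hr,
      add_tsub_cancel_left, Finset.sdiff_singleton_eq_erase]
  rw [card_commute_rooted r.2, forestSum_cycleWeight (cycleLength σ) (by simp), herase, hr]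

end FixedTrees

section Partitions

variable {n : ℕ}

/-- The exponent of `p_μ`, regarded as a monomial in the power sums. -/
def partExp (μ : n.Partition) : ℕ+ →₀ ℕ := Multiset.toFinsupp (μ.parts.map Nat.toPNat')

theorem map_coe_map_toPNat'_parts (μ : n.Partition) :
    (μ.parts.map Nat.toPNat').map PNat.val = μ.parts := by
  rw [Multiset.map_map]
  refine (Multiset.map_congr rfl fun k hk => ?_).trans (Multiset.map_id _)
  rw [Function.comp_apply, Nat.toPNat'_coe, if_pos (μ.parts_pos hk), id]

theorem partExp_apply (μ : n.Partition) (k : ℕ+) : partExp μ k = μ.parts.count (k : ℕ) := by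
  conv_rhs => rw [← map_coe_map_toPNat'_parts μ]
  rw [partExp, Multiset.toFinsupp_apply]
  exact (Multiset.count_map_eq_count' PNat.val _ PNat.coe_injective k).symm

theorem partExp_eq_partExp_iff {m : ℕ} {μ : m.Partition} {ν : n.Partition} :
    partExp μ = partExp ν ↔ μ.parts = ν.parts := by
  refine ⟨fun h => ?_, fun h => by rw [partExp, partExp, h]⟩
  rw [← map_coe_map_toPNat'_parts μ, Multiset.toFinsupp.injective h, map_coe_map_toPNat'_parts]

theorem size_eq_of_partExp_eq {m : ℕ} {μ : m.Partition} {ν : n.Partition}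
    (h : partExp μ = partExp ν) : m = n := by
  rw [← μ.parts_sum, ← ν.parts_sum, partExp_eq_partExp_iff.1 h]

theorem exists_partExp_eq (d : ℕ+ →₀ ℕ) : ∃ (n : ℕ) (μ : n.Partition), partExp μ = d := by
  have hpos {a} (ha : a ∈ (Finsupp.toMultiset d).map PNat.val) : 0 < a := by
    obtain ⟨k, -, rfl⟩ := Multiset.mem_map.1 ha
    exact k.pos
  refine ⟨_, ⟨(Finsupp.toMultiset d).map PNat.val, hpos, rfl⟩, ?_⟩
  have hid : Nat.toPNat' ∘ PNat.val = id := funext PNat.coe_toPNat'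
  rw [partExp, Multiset.map_map, hid, Multiset.map_id, Finsupp.toMultiset_toFinsupp]

theorem pPart_eq_monomial (μ : n.Partition) : pPart μ = monomial (partExp μ) (1 : Coef) := by
  rw [pPart, partExp]
  induction μ.parts using Multiset.induction_on with
  | empty => simp
  | cons a s ih =>
    rw [Multiset.map_cons, Multiset.prod_cons, ih, Multiset.map_cons, ← Multiset.singleton_add,
      map_add, Multiset.toFinsupp_singleton, pSum, X, monomial_mul_monomial, one_mul]

theorem zPart_eq_zExp (μ : n.Partition) : zPart μ = zExp (partExp μ) := by
  have hsupp : μ.parts.toFinset =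
      (partExp μ).support.map ⟨PNat.val, PNat.coe_injective⟩ := by
    conv_lhs => rw [← map_coe_map_toPNat'_parts μ, Multiset.toFinset_map]
    rw [Finset.map_eq_image, partExp, Multiset.toFinsupp_support]
    rfl
  rw [zPart, zExp, Finsupp.prod, hsupp, Finset.prod_map]
  exact Finset.prod_congr rfl fun k _ => by rw [partExp_apply]; rfl

theorem zPart_perm_partition {V : Type*} [Fintype V] [DecidableEq V] (σ : Equiv.Perm V) :
    zPart σ.partition = (Fintype.card V - σ.cycleType.sum).factorial * σ.cycleType.prod *
      ∏ k ∈ σ.cycleType.toFinset, (σ.cycleType.count k).factorial := by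
  have hone : (1 : ℕ) ∉ σ.cycleType := fun h =>
    absurd (Equiv.Perm.two_le_of_mem_cycleType h) (by simp)
  have hcount_one : σ.partition.parts.count 1 = Fintype.card V - σ.cycleType.sum := by
    rw [Equiv.Perm.parts_partition, Multiset.count_add, Multiset.count_eq_zero_of_notMem hone,
      Multiset.count_replicate_self, zero_add, Equiv.Perm.sum_cycleType]
  have hcount : ∀ k ∈ σ.cycleType.toFinset, σ.partition.parts.count k = σ.cycleType.count k := by
    intro k hk
    have hk := Equiv.Perm.two_le_of_mem_cycleType (Multiset.mem_toFinset.1 hk)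
    rw [← Equiv.Perm.filter_parts_partition_eq_cycleType, Multiset.count_filter_of_pos hk]
  have hsub : σ.partition.parts.toFinset ⊆ insert 1 σ.cycleType.toFinset := fun k => by
    rw [Equiv.Perm.parts_partition, Multiset.mem_toFinset, Multiset.mem_add, Finset.mem_insert,
      Multiset.mem_toFinset]
    exact Or.rec Or.inr fun h => Or.inl (Multiset.eq_of_mem_replicate h)
  rw [zPart, Finset.prod_subset hsub fun k _ hk => by
      rw [Multiset.count_eq_zero_of_notMem fun h => hk (Multiset.mem_toFinset.2 h), pow_zero,
        Nat.factorial_zero, mul_one],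
    Finset.prod_insert fun h => hone (Multiset.mem_toFinset.1 h), hcount_one, one_pow, one_mul,
    Finset.prod_multiset_count, mul_assoc, ← Finset.prod_mul_distrib,
    Finset.prod_congr rfl fun k hk => by rw [hcount k hk]]

theorem card_isConj_mul_zPart {V : Type*} [Fintype V] [DecidableEq V] (σ : Equiv.Perm V) :
    (Finset.univ.filter fun τ => IsConj τ σ).card * zPart σ.partition =
      (Fintype.card V).factorial := by
  have h := Equiv.Perm.card_isConj_mul_eq σ
  rw [← zPart_perm_partition, Nat.card_coe_set_eq, Set.ncard_eq_toFinset_card'] at h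
  simpa only [Set.toFinset_ofPred, isConj_comm] using h

theorem partExp_partition_eq_iff_isConj {σ τ : Equiv.Perm (Fin n)} :
    partExp τ.partition = partExp σ.partition ↔ IsConj τ σ := by
  rw [Equiv.Perm.partition_eq_of_isConj, partExp_eq_partExp_iff, Nat.Partition.ext_iff]

theorem lengthCount_eq_partExp (σ : Equiv.Perm (Fin n)) :
    lengthCount (cycleLength σ) Finset.univ = partExp σ.partition :=
  Finsupp.ext fun k => by rw [partExp_apply, lengthCount_eq_count_parts]

theorem fixPow_eq_fixedLoad (μ : n.Partition) (k : ℕ+) :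
    fixPow μ k = fixedLoad k (partExp μ) := by
  obtain ⟨σ, hσ⟩ := exists_perm_of_type μ
  rw [fixPow_eq μ k σ hσ, card_fixed_pow, lengthCount_eq_partExp, partExp_eq_partExp_iff.2 hσ]

end Partitions

section RootedTrees

theorem trace_ofMulAction (R : Type*) [CommRing R] {G H : Type*} [Group G] [MulAction G H]
    [Finite H] (g : G) :
    LinearMap.trace R _ (Representation.ofMulAction R G H g) =
      (Nat.card {h : H // g • h = h} : R) := by
  classical
  have := Fintype.ofFinite H
  let b : Module.Basis H R (MonoidAlgebra R H) :=
    Module.Basis.ofRepr (MonoidAlgebra.coeffLinearEquiv R)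
  rw [LinearMap.trace_eq_matrix_trace R b, Matrix.trace, Nat.card_eq_fintype_card,
    Fintype.card_subtype, Finset.card_filter, Nat.cast_sum]
  refine Finset.sum_congr rfl fun h _ => ?_
  have hb : b h = MonoidAlgebra.single h 1 := rfl
  rw [Matrix.diag_apply, LinearMap.toMatrix_apply, hb, Representation.ofMulAction_single]
  change (MonoidAlgebra.single (g • h) (1 : R)).coeff h = _
  simp [Finsupp.single_apply]

variable {n : ℕ} {V : Type} [AddCommGroup V] [Module ℚ V]
  (ρ : Representation ℚ (Equiv.Perm (Fin n)) V)

theorem coeff_frobeniusChar (d : ℕ+ →₀ ℕ) :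
    coeff d (frobeniusChar ρ) = 1 / (n.factorial : Coef) * ∑ σ : Equiv.Perm (Fin n),
      if partExp σ.partition = d then algebraMap ℚ Coef (ρ.character σ) else 0 := by
  classical
  rw [frobeniusChar, coeff_C_mul, map_sum]
  congr 1
  refine Finset.sum_congr rfl fun σ _ => ?_
  rw [pPart_eq_monomial, coeff_C_mul, coeff_monomial, mul_ite, mul_one, mul_zero]
  exact if_congr eq_comm rfl rfl

theorem coeff_frobeniusChar_eq_zero {m : ℕ} (μ : m.Partition) (h : m ≠ n) :
    coeff (partExp μ) (frobeniusChar ρ) = 0 := by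
  rw [coeff_frobeniusChar, Finset.sum_eq_zero fun σ _ => if_neg fun hσ =>
    h ((size_eq_of_partExp_eq hσ).symm.trans (Fintype.card_fin n)), mul_zero]

theorem zPart_mul_coeff_frobeniusChar (σ : Equiv.Perm (Fin n)) :
    (zPart σ.partition : Coef) * coeff (partExp σ.partition) (frobeniusChar ρ) =
      algebraMap ℚ Coef (ρ.character σ) := by
  classical
  have hchar : ∀ τ ∈ Finset.univ.filter fun τ => IsConj τ σ,
      algebraMap ℚ Coef (ρ.character τ) = algebraMap ℚ Coef (ρ.character σ) := fun τ hτ => by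
    obtain ⟨c, hc⟩ := isConj_iff.1 (Finset.mem_filter.1 hτ).2
    rw [← hc, Representation.char_conj]
  have hcard : (zPart σ.partition : Coef) * (Finset.univ.filter fun τ => IsConj τ σ).card =
      n.factorial := by
    rw [mul_comm, ← Nat.cast_mul, card_isConj_mul_zPart σ, Fintype.card_fin]
  have hn : (n.factorial : Coef) ≠ 0 := Nat.cast_ne_zero.2 n.factorial_ne_zero
  simp only [coeff_frobeniusChar, partExp_partition_eq_iff_isConj]
  rw [← Finset.sum_filter, Finset.sum_congr rfl hchar, Finset.sum_const, nsmul_eq_mul,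
    mul_left_comm, ← mul_assoc (zPart σ.partition : Coef), hcard, ← mul_assoc,
    one_div_mul_cancel hn, one_mul]

theorem coeff_frobeniusChar_tree (μ : n.Partition) :
    coeff (partExp μ) (frobeniusChar (Representation.ofMulAction ℚ (Equiv.Perm (Fin n))
      (LabelledRootedTree (Fin n)))) = coeff (partExp μ) (treeSeries Coef 1) := by
  obtain ⟨σ, hσ⟩ := exists_perm_of_type μ
  have hz : (zPart σ.partition : Coef) ≠ 0 := Nat.cast_ne_zero.2 fun h =>
    (Fintype.card (Fin n)).factorial_ne_zero (by rw [← card_isConj_mul_zPart σ, h, mul_zero])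
  rw [← partExp_eq_partExp_iff.2 hσ]
  refine mul_left_cancel₀ hz ?_
  rw [zPart_mul_coeff_frobeniusChar, Representation.character, trace_ofMulAction, map_natCast,
    card_fixedTree, lengthCount_eq_partExp, zPart_eq_zExp]

theorem symPreLie_eq_treeSeries : symPreLie = treeSeries Coef 1 := by
  ext d
  obtain ⟨n, μ, rfl⟩ := exists_partExp_eq d
  exact (finsum_eq_single _ n fun m hm => coeff_frobeniusChar_eq_zero _ μ hm.symm).trans
    (coeff_frobeniusChar_tree μ)

end RootedTrees

section Expansion

theorem sub_div_eq_eval_abelPoly {K : Type*} [Field K] (k w : K) (m : ℕ) :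
    ((w + k * m) ^ m - k * m * (w + k * m) ^ ((m : ℤ) - 1)) / (k ^ m * m.factorial) =
      (abelPoly k m).eval w := by
  rcases m with _ | m
  · simp [abelPoly_zero]
  · rw [eval_abelPoly_succ, Nat.cast_succ (R := ℤ), add_sub_cancel_right, zpow_natCast,
      div_eq_inv_mul]
    push_cast
    ring

theorem zpow_sub_one_div_factorial {K : Type*} [Field K] {t : K} (ht : t ≠ 0) (m : ℕ) :
    ((m : K) - t) ^ ((m : ℤ) - 1) / m.factorial = -(1 / t) * (abelPoly 1 m).eval (-t) := by
  rcases m with _ | m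
  · simp [abelPoly_zero, zpow_neg, inv_neg]
  · rw [eval_abelPoly_succ, Nat.cast_succ (R := ℤ), add_sub_cancel_right, zpow_natCast, one_pow,
      one_mul, one_mul, neg_add_eq_sub, Nat.cast_succ m]
    field_simp

theorem tVar_ne_zero : tVar ≠ 0 := RatFunc.X_ne_zero

theorem mult_eq_partExp {n : ℕ} (μ : n.Partition) (k : ℕ+) : mult μ k = partExp μ k :=
  (partExp_apply μ k).symm

theorem support_partExp_subset {n : ℕ} (μ : (n + 1).Partition) :
    (partExp μ).support ⊆ insert 1 (Finset.Icc 2 n.succPNat) := fun k hk => by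
  rw [Finsupp.mem_support_iff, partExp_apply, Multiset.count_ne_zero] at hk
  rw [Finset.mem_insert, Finset.mem_Icc, or_iff_not_imp_left]
  exact fun hk1 => ⟨PNat.add_one_le_iff.2 (one_le.lt_of_ne' hk1), μ.le_of_mem_parts hk⟩

theorem expansionCoeff_div_zPart {n : ℕ} (μ : (n + 1).Partition) :
    expansionCoeff μ / zPart μ =
      -(1 / tVar) * coeff (partExp μ) (forestSeries fun k : ℕ+ => -tVar ^ (k : ℕ)) := by
  have hone : (1 : ℕ+) ∉ Finset.Icc 2 n.succPNat := fun h =>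
    absurd (Finset.mem_Icc.1 h).1 (by decide)
  have hfix (k : ℕ+) : (fixPow μ k : Coef) - tVar ^ (k : ℕ) =
      -tVar ^ (k : ℕ) + properLoad k (partExp μ) + (k : ℕ) * partExp μ k := by
    rw [fixPow_eq_fixedLoad, fixedLoad_eq]
    push_cast
    ring
  have hIcc : Finset.Icc 2 (n + 1) =
      (Finset.Icc 2 n.succPNat).map ⟨PNat.val, PNat.coe_injective⟩ :=
    (PNat.map_subtype_embedding_Icc 2 n.succPNat).symm
  rw [zPart_eq_zExp, zExp, Finsupp.prod_of_support_subset _ (support_partExp_subset μ) _ (by simp),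
    coeff_forestSeries_of_subset _ _ (support_partExp_subset μ), Finset.prod_insert hone,
    Finset.prod_insert hone, expansionCoeff, hIcc, Finset.prod_map, Nat.cast_mul, Nat.cast_prod,
    mul_div_mul_comm, ← Finset.prod_div_distrib, ← mul_assoc]
  congr 1
  · have hmult : mult μ 1 = partExp μ 1 := mult_eq_partExp μ 1
    rw [properLoad_eq_zero fun _ _ _ => one_le, hmult]
    simpa using zpow_sub_one_div_factorial tVar_ne_zero (partExp μ 1)
  · refine Finset.prod_congr rfl fun k _ => ?_
    rw [Function.Embedding.coeFn_mk, mult_eq_partExp, hfix, ← sub_div_eq_eval_abelPoly]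
    push_cast
    rfl

theorem coeff_C_mul_pPart {n : ℕ} (c : Coef) (μ : n.Partition) (d : ℕ+ →₀ ℕ) :
    coeff d (C c * pPart μ) = if partExp μ = d then c else 0 := by
  classical
  rw [pPart_eq_monomial, coeff_C_mul, coeff_monomial, mul_ite, mul_one, mul_zero]
  exact if_congr eq_comm rfl rfl

theorem sigma_partExp_injective :
    Function.Injective fun μ : Σ n : ℕ, (n + 1).Partition => partExp μ.2 := by
  rintro ⟨m, μ⟩ ⟨n, ν⟩ h
  obtain rfl : m = n := Nat.succ_injective (size_eq_of_partExp_eq h)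
  obtain rfl : μ = ν := Nat.Partition.ext (partExp_eq_partExp_iff.1 h)
  rfl

theorem formallySummable_pPart (c : (Σ n : ℕ, (n + 1).Partition) → Coef) :
    FormallySummable fun μ => C (c μ) * pPart μ.2 := fun d =>
  ((Set.finite_singleton d).preimage sigma_partExp_injective.injOn).subset fun _ hμ =>
    by_contra fun h => hμ ((coeff_C_mul_pPart _ _ _).trans (if_neg h))

theorem partExp_partition_zero (μ : Nat.Partition 0) : partExp μ = 0 := by
  rw [Subsingleton.elim μ default, partExp]
  exact map_zero _

theorem partExp_ne_zero {n : ℕ} (μ : (n + 1).Partition) : partExp μ ≠ 0 := fun h =>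
  n.succ_ne_zero (size_eq_of_partExp_eq (h.trans (partExp_partition_zero default).symm))

theorem formalSum_coeff_mul_pPart {f : SymFn} (hf : coeff 0 f = 0) :
    formalSum (fun μ : Σ n : ℕ, (n + 1).Partition =>
      C (coeff (partExp μ.2) f) * pPart μ.2) = f := by
  ext d
  change ∑ᶠ μ : Σ n : ℕ, (n + 1).Partition, coeff d (C (coeff (partExp μ.2) f) * pPart μ.2) = _
  simp only [coeff_C_mul_pPart]
  obtain ⟨_ | n, μ, rfl⟩ := exists_partExp_eq d
  · rw [partExp_partition_zero, hf]
    exact finsum_eq_zero_of_forall_eq_zero fun ν => if_neg (partExp_ne_zero ν.2)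
  · refine (finsum_eq_single _ ⟨n, μ⟩ fun ν hν => if_neg fun h => hν ?_).trans (if_pos rfl)
    exact sigma_partExp_injective h

end Expansion

end

/-- The sum runs over the partitions of all positive integers. -/
theorem mainTheorem5 :
    FormallySummable (fun μ : Σ n : ℕ, (n + 1).Partition =>
      C (expansionCoeff μ.2 / (zPart μ.2 : Coef)) * pPart μ.2) ∧
    plethysm (suspension symComm) symPreLie =
      formalSum (fun μ : Σ n : ℕ, (n + 1).Partition =>
        C (expansionCoeff μ.2 / (zPart μ.2 : Coef)) * pPart μ.2) := by
  refine ⟨formallySummable_pPart _, ?_⟩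
  have hconst : coeff 0 (C (-(1 / tVar)) *
      (forestSeries (fun k : ℕ+ => -tVar ^ (k : ℕ)) - 1)) = 0 := by
    rw [coeff_C_mul, map_sub, coeff_forestSeries, Finsupp.support_zero, Finset.prod_empty,
      coeff_zero_one, sub_self, mul_zero]
  rw [symPreLie_eq_treeSeries, plethysm_suspension_symComm_treeSeries,
    ← formalSum_coeff_mul_pPart hconst]
  refine congrArg formalSum (funext fun μ => ?_)
  classical
  rw [coeff_C_mul, map_sub, coeff_one, if_neg (partExp_ne_zero μ.2), sub_zero,
    expansionCoeff_div_zPart]
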